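/- Let $V$ be a finite-dimensional complex vector space with a hermitian inner product $\langle\,,\rangle$ (linear in the first variable), and let $G\subset GL(V)$ be a finite group that preserves $\langle\,,\rangle$ and is generated by pseudo-reflections (elements $\neq 1$ that fix a hyperplane pointwise). Let $\mathcal A$ be the set of reflection hyperplanes of $G$. For $H\in\mathcal A$ let $G_H$ be the subgroup of the elements of $G$ fixing $H$ pointwise, $e_H=|G_H|$, $\zeta_H=\exp(2\pi\sqrt{-1}/e_H)$, and let $g_H$ be the unique element of $G_H$ with determinant $\zeta_H$. For every $H\in\mathcal A$ fix $v_H\in H^\perp\setminus\{0\}$; put $\alpha_H(\xi)=\langle\xi,v_H\rangle$ and define $\lambda(g,H)\in\mathbb C^\times$ by $g(v_H)=\lambda(g,H)v_{gH}$. Let $M_G$ be the vector space with basis the symbols $[H;k]$ ($H\in\mathcal A$, $1\le k\le e_H-1$), with the $G$-action $g([H;k])=\overline{\lambda(g,H)}^{-1}[gH;k]$, the $G$-grading $\deg [H;k]=g_H^k$ and the braiding $\Psi(x\otimes y)=g(y)\otimes x$ for $x$ of degree $g$. For $w\in S_n$ with reduced expression $w=s_{i_1}\cdots s_{i_l}$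 put $\Psi_w=\Psi_{i_1}\cdots\Psi_{i_l}$ on $M_G^{\otimes n}$, where $\Psi_i$ is $\Psi$ on the factors $i,i+1$; put $\sigma_n=\sum_{w\in S_n}\Psi_w$, and let $\mathcal B(M_G)=\bigoplus_{n\ge 0}M_G^{\otimes n}/\operatorname{Ker}\sigma_n$ be the Nichols–Woronowicz algebra, a quotient algebra of the tensor algebra $T(M_G)$. The group $G$ acts on it diagonally. Let $\kappa=(\kappa_{H,i})_{H\in\mathcal A,\,1\le i\le e_H-1}$ be complex constants with $\kappa_{gH,i}=\kappa_{H,i}$ for $g\in G$, and let $\mu:V\to M_G$, $$\mu(\xi)=-\sum_{H\in\mathcal A}\ \sum_{i,k=1}^{e_H-1}\alpha_H(\xi)\,\kappa_{H,i}\,\zeta_H^{-ik}\,[H;k].$$ Then $\mu$ extends to a unique algebra homomorphism $\tilde\mu:S(V)\to\mathcal B(M_G)$ on the symmetric algebra of $V$. For $H\in\mathcal A$ and $1\le k\le e_H-1$ there is a unique linear map $\phi\mapsto\phi\overleftarrow D_{H,k}$ of $\mathcal B(M_G)$ to itself (the braided derivation) such that $[H';k']\overleftarrow D_{H,k}=\delta_{H,H'}\delta_{k,k'}$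 and such that, for the product $\phi\star\psi=\psi\phi$ of the opposite algebra of $\mathcal B(M_G)$, the right braided Leibniz rule $$(\phi\star\psi)\overleftarrow D_{H,k}=\phi\star(\psi\overleftarrow D_{H,k})+(\phi\overleftarrow D_{H,k})\star g_H^{-k}(\psi)$$ holds; in the product of $\mathcal B(M_G)$ this reads $(\psi\phi)\overleftarrow D_{H,k}=(\psi\overleftarrow D_{H,k})\phi+g_H^{-k}(\psi)(\phi\overleftarrow D_{H,k})$. For $f\in S(V)$ let $f\overleftarrow\Delta_{H,k}=\bigl(f-g_H^{-k}(f)\bigr)/v_H\in S(V)$. Then, for all $f\in S(V)$, $$C_{H,k}\,\tilde\mu(f\overleftarrow\Delta_{H,k})=\tilde\mu(f)\overleftarrow D_{H,k},\qquad C_{H,k}=\sum_{i=1}^{e_H-1}\kappa_{H,i}\,\frac{\zeta_H^{-ik}\,\|v_H\|^2}{\zeta_H^{-k}-1}.$$ -/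

import Mathlib

open scoped BigOperators

noncomputable section

namespace ReflNichols

/-! ### Braidings of group type, Woronowicz symmetrizers, Nichols-Woronowicz algebras

`M` is the vector space with basis `I`. It carries operators `act g` for `g` in a group `Γ`, and the
basis vector `x` is homogeneous of degree `deg x` in `Γ`. The tensor algebra of `M` is the free
algebra on `I`, whose basis consists of the words in `I`. -/

section Nichols

variable {I Γ : Type*}

/-- The inclusion of `M` in its tensor algebra `T(M)`. -/
def incl : (I →₀ ℂ) →ₗ[ℂ] FreeAlgebra ℂ I :=
  Finsupp.linearCombination ℂ (FreeAlgebra.ι ℂ)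

/-- The homogeneous word `x₁ ⊗ ... ⊗ xₙ` in `T(M)`. -/
def word (l : List I) : FreeAlgebra ℂ I := (l.map (FreeAlgebra.ι ℂ)).prod

/-- The summand `M^{⊗ n}` of `T(M)`. -/
def tensorPow (I : Type*) (n : ℕ) : Submodule ℂ (FreeAlgebra ℂ I) :=
  Submodule.span ℂ {t | ∃ l : List I, l.length = n ∧ t = word l}

/-- The diagonal operator of `g` on `T(M)`, `g (x₁ ⊗ ... ⊗ xₙ) = g x₁ ⊗ ... ⊗ g xₙ`. -/
def actT (act : Γ → (I →₀ ℂ) →ₗ[ℂ] (I →₀ ℂ)) (g : Γ) : FreeAlgebra ℂ I →ₐ[ℂ] FreeAlgebra ℂ I :=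
  FreeAlgebra.lift ℂ fun x => incl (act g (Finsupp.single x 1))

/-- The braiding `x ⊗ y ↦ (deg x) y ⊗ x` of `M ⊗ M` applied to a word at the (zero-based) places `i`
and `i + 1`. The last clause, for words that are too short, is never used below. -/
def braidWord (act : Γ → (I →₀ ℂ) →ₗ[ℂ] (I →₀ ℂ)) (deg : I → Γ) : ℕ → List I → FreeAlgebra ℂ I
  | 0, x :: y :: l => incl (act (deg x) (Finsupp.single y 1)) * FreeAlgebra.ι ℂ x * word l
  | i + 1, x :: l => FreeAlgebra.ι ℂ x * braidWord act deg i l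
  | _, l => word l

/-- The operator `Ψ_i`: the braiding on the tensor factors `i` and `i + 1` (zero-based). -/
def braidAt (act : Γ → (I →₀ ℂ) →ₗ[ℂ] (I →₀ ℂ)) (deg : I → Γ) (i : ℕ) :
    Module.End ℂ (FreeAlgebra ℂ I) :=
  (FreeAlgebra.basisFreeMonoid ℂ I).constr ℂ fun w => braidWord act deg i w.toList

/-- The permutation of `Fin n` obtained from `w` in `S_{n+1}` by removing the last point `n` from the
target and its preimage `p` from the source, and renumbering the source increasingly. -/
def dropLast {n : ℕ} (w : Equiv.Perm (Fin (n + 1))) : Equiv.Perm (Fin n) :=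
  Equiv.removeNone
    ((finSuccEquiv' (w.symm (Fin.last n))).symm.trans (w.trans (finSuccEquiv' (Fin.last n))))

/-- A reduced word of `w` in `S_n`; the letter `i` stands for the transposition of `i` and `i + 1`.
With `p` the preimage of the last point, `w = (dropLast w) s_{n-1} s_{n-2} ... s_p` in `S_{n+1}`.
That this is a reduced expression is shown in `redWord_apply` and `redWord_length`. -/
def redWord : (n : ℕ) → Equiv.Perm (Fin n) → List ℕ
  | 0, _ => []
  | n + 1, w =>
      redWord n (dropLast w) ++
        (List.range' (w.symm (Fin.last n)) (n - (w.symm (Fin.last n) : ℕ))).reverse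

theorem dropLast_spec {n : ℕ} (w : Equiv.Perm (Fin (n + 1))) (j : Fin n) :
    (dropLast w j).castSucc = w ((w.symm (Fin.last n)).succAbove j) := by
  set p := w.symm (Fin.last n) with hp
  have hne : w (p.succAbove j) ≠ Fin.last n := by
    intro h
    exact Fin.succAbove_ne p j (by simpa [hp] using congrArg w.symm h)
  obtain ⟨a, ha⟩ := Fin.exists_castSucc_eq.2 hne
  have h1 : ((finSuccEquiv' p).symm.trans (w.trans (finSuccEquiv' (Fin.last n)))) (some j)
      = some a := by
    simp [← ha]
  have h2 := Equiv.removeNone_some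
    ((finSuccEquiv' p).symm.trans (w.trans (finSuccEquiv' (Fin.last n)))) ⟨a, h1⟩
  rw [h1] at h2
  rw [← ha]
  exact congrArg Fin.castSucc (Option.some.inj h2)

theorem cycleWord_apply (p m j : ℕ) :
    ((List.range' p m).reverse.map fun i => Equiv.swap i (i + 1)).prod j =
      if j = p then p + m else if p < j ∧ j ≤ p + m then j - 1 else j := by
  induction m with
  | zero => simp; grind
  | succ m ih =>
    rw [List.range'_concat]
    simp only [List.reverse_append, List.reverse_singleton, List.singleton_append, List.map_cons,
      List.prod_cons, Equiv.Perm.mul_apply, one_mul, ih, Equiv.swap_apply_def]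
    grind

theorem redWord_apply_of_le (n : ℕ) (w : Equiv.Perm (Fin n)) {k : ℕ} (hk : n ≤ k) :
    ((redWord n w).map fun i => Equiv.swap i (i + 1)).prod k = k := by
  induction n with
  | zero => simp [redWord]
  | succ n ih =>
    have hpn : (w.symm (Fin.last n) : ℕ) ≤ n := Nat.lt_succ_iff.1 (w.symm (Fin.last n)).2
    simp only [redWord, List.map_append, List.prod_append, Equiv.Perm.mul_apply]
    rw [cycleWord_apply, if_neg (by omega), if_neg (by omega), ih _ (by omega)]

/-- The letters of `redWord n w` multiply to `w`. -/
theorem redWord_apply (n : ℕ) (w : Equiv.Perm (Fin n)) (j : Fin n) :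
    ((redWord n w).map fun i => Equiv.swap i (i + 1)).prod (j : ℕ) = (w j : ℕ) := by
  induction n with
  | zero => exact j.elim0
  | succ n ih =>
    set p := w.symm (Fin.last n) with hp
    have hpn : (p : ℕ) ≤ n := Nat.lt_succ_iff.1 p.2
    simp only [redWord, List.map_append, List.prod_append, Equiv.Perm.mul_apply]
    rw [← hp, cycleWord_apply]
    rcases Fin.eq_self_or_eq_succAbove p j with rfl | ⟨i, rfl⟩
    · rw [if_pos rfl, Nat.add_sub_cancel' hpn, redWord_apply_of_le n _ le_rfl]
      simp [hp]
    · rw [← dropLast_spec, Fin.val_castSucc, ← ih]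
      congr 1
      simp only [Fin.succAbove, Fin.lt_def, Fin.val_castSucc]
      grind

/-- The length of `redWord n w` is the number of inversions of `w`, so the word is reduced. -/
theorem redWord_length (n : ℕ) (w : Equiv.Perm (Fin n)) :
    (redWord n w).length = ∑ i : Fin n, ∑ j : Fin n, if i < j ∧ w j < w i then 1 else 0 := by
  induction n with
  | zero => simp [redWord]
  | succ n ih =>
    set p := w.symm (Fin.last n) with hp
    have hwp : w p = Fin.last n := by simp [hp]
    simp only [redWord, List.length_append, List.length_reverse, List.length_range', ih]
    rw [← hp, Fin.sum_univ_succAbove _ p]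
    simp only [Fin.sum_univ_succAbove _ p, hwp, lt_irrefl, if_false, zero_add,
      not_lt_of_ge (Fin.le_last _), and_false]
    simp only [hp, ← dropLast_spec, Fin.succAbove_lt_succAbove_iff, Fin.castSucc_lt_castSucc_iff,
      Fin.castSucc_lt_last, and_true]
    rw [← hp, add_comm]
    congr 1
    have h (j : Fin n) : p < p.succAbove j ↔ (p : ℕ) ≤ (j : ℕ) := Fin.lt_succAbove_iff_le_castSucc p j
    simp only [h]
    rw [Fin.sum_univ_eq_sum_range (fun j => if (p : ℕ) ≤ j then 1 else 0) n,
      Finset.sum_boole, Nat.cast_id, ← Nat.card_Ico]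
    congr 1
    ext j
    simp [and_comm]

/-- `Ψ_w = Ψ_{i_1} ... Ψ_{i_l}` for a reduced expression `w = s_{i_1} ... s_{i_l}`. -/
def braidPerm (act : Γ → (I →₀ ℂ) →ₗ[ℂ] (I →₀ ℂ)) (deg : I → Γ) {n : ℕ} (w : Equiv.Perm (Fin n)) :
    Module.End ℂ (FreeAlgebra ℂ I) :=
  ((redWord n w).map (braidAt act deg)).prod

/-- The Woronowicz symmetrizer `σ_n = ∑_{w ∈ S_n} Ψ_w`, to be applied to elements of `M^{⊗ n}`. -/
def symmetrizer (act : Γ → (I →₀ ℂ) →ₗ[ℂ] (I →₀ ℂ)) (deg : I → Γ) (n : ℕ) :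
    Module.End ℂ (FreeAlgebra ℂ I) :=
  ∑ w : Equiv.Perm (Fin n), braidPerm act deg w

/-- The relations of the Nichols-Woronowicz algebra: `t = 0` for `t` in `M^{⊗ n}`, `σ_n t = 0`. -/
inductive NicholsRel (act : Γ → (I →₀ ℂ) →ₗ[ℂ] (I →₀ ℂ)) (deg : I → Γ) :
    FreeAlgebra ℂ I → FreeAlgebra ℂ I → Prop
  | ker (n : ℕ) (t : FreeAlgebra ℂ I) (ht : t ∈ tensorPow I n)
      (h0 : symmetrizer act deg n t = 0) : NicholsRel act deg t 0

/-- The Nichols-Woronowicz algebra `B(M) = ⨁ M^{⊗ n} / Ker σ_n`, as the quotient algebra of `T(M)` by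
the kernels of all `σ_n` (for a braided space `M` their sum is a two-sided ideal). -/
abbrev Nichols (act : Γ → (I →₀ ℂ) →ₗ[ℂ] (I →₀ ℂ)) (deg : I → Γ) : Type _ :=
  RingQuot (NicholsRel act deg)

/-- The projection `T(M) → B(M)`. -/
abbrev toNichols (act : Γ → (I →₀ ℂ) →ₗ[ℂ] (I →₀ ℂ)) (deg : I → Γ) :
    FreeAlgebra ℂ I →ₐ[ℂ] Nichols act deg :=
  RingQuot.mkAlgHom ℂ (NicholsRel act deg)

end Nichols

/-! ### Finite complex reflection groups -/

section Reflection

variable {V : Type*} [NormedAddCommGroup V] [InnerProductSpace ℂ V]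

/-- `g` is a pseudo-reflection with reflection hyperplane `H`: `g ≠ 1`, and `g` fixes the hyperplane
`H` pointwise. -/
def IsReflectionAlong (g : V ≃ₗ[ℂ] V) (H : Submodule ℂ V) : Prop :=
  IsCoatom H ∧ g ≠ 1 ∧ ∀ x ∈ H, g x = x

/-- `G` is generated by the pseudo-reflections it contains. -/
def IsReflectionGroup (G : Subgroup (V ≃ₗ[ℂ] V)) : Prop :=
  Subgroup.closure {g : V ≃ₗ[ℂ] V | g ∈ G ∧ ∃ H, IsReflectionAlong g H} = G

/-- The set of reflection hyperplanes of `G`. -/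
def Hyp (G : Subgroup (V ≃ₗ[ℂ] V)) : Type _ :=
  {H : Submodule ℂ V // ∃ g ∈ G, IsReflectionAlong g H}

variable {G : Subgroup (V ≃ₗ[ℂ] V)}

/-- `G` permutes its reflection hyperplanes, `H ↦ gH`. -/
instance : MulAction G (Hyp G) where
  smul g H := ⟨H.1.map (g.1 : V →ₗ[ℂ] V), by
    obtain ⟨s, hs, hH, hs1, hfix⟩ := H.2
    refine ⟨g.1 * s * g.1⁻¹, G.mul_mem (G.mul_mem g.2 hs) (G.inv_mem g.2),
      ((Submodule.orderIsoMapComap g.1).isCoatom_iff H.1).2 hH, ?_, ?_⟩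
    · intro h
      apply hs1
      have h2 : g.1 * s = g.1 := by simpa using mul_inv_eq_iff_eq_mul.1 h
      simpa using h2
    · rintro _ ⟨x, hx, rfl⟩
      have h3 : g.1⁻¹ (g.1 x) = x := g.1.symm_apply_apply x
      show g.1 (s (g.1⁻¹ (g.1 x))) = g.1 x
      rw [h3, hfix x hx]⟩
  one_smul H := Subtype.ext (Submodule.map_id H.1)
  mul_smul g h H := Subtype.ext (Submodule.map_comp (h.1 : V →ₗ[ℂ] V) (g.1 : V →ₗ[ℂ] V) H.1)

/-- A finite group has finitely many reflection hyperplanes. -/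
instance [Finite G] : Finite (Hyp G) := by
  choose f hfG hf using fun H : Hyp G => H.2
  refine Finite.of_injective (fun H => (⟨f H, hfG H⟩ : G)) fun H K hHK => ?_
  have hfe : f H = f K := congrArg Subtype.val hHK
  let F : Submodule ℂ V := LinearMap.eqLocus (f H : V →ₗ[ℂ] V) LinearMap.id
  have hF : F ≠ ⊤ := fun h => (hf H).2.1 (by
    ext x
    have hx : x ∈ F := h ▸ Submodule.mem_top
    exact hx)
  have h1 : H.1 ≤ F := fun x hx => (hf H).2.2 x hx
  have h2 : K.1 ≤ F := fun x hx => by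
    show f H x = x
    rw [hfe]; exact (hf K).2.2 x hx
  have e1 : F = H.1 := ((hf H).1.le_iff.1 h1).resolve_left hF
  have e2 : F = K.1 := ((hf K).1.le_iff.1 h2).resolve_left hF
  exact Subtype.ext (e1.symm.trans e2)

instance [Finite G] : Fintype (Hyp G) := Fintype.ofFinite _

/-- The group `G_H` of the elements of `G` that fix `H` pointwise. -/
def stab (H : Hyp G) : Subgroup G := fixingSubgroup G (H.1 : Set V)

/-- `e_H`, the order of `G_H`. -/
def ord (H : Hyp G) : ℕ := Nat.card (stab H)

theorem ord_smul (g : G) (H : Hyp G) : ord (g • H) = ord H := by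
  have h : (stab H).map (MulAut.conj g).toMonoidHom = stab (g • H) := by
    refine SubMulAction.fixingSubgroup_map_conj_eq ?_
    ext x
    simp only [Set.mem_smul_set]
    rfl
  unfold ord
  rw [← h]
  exact (Nat.card_congr ((stab H).equivMapOfInjective _ (MulAut.conj g).injective).toEquiv).symm

/-- `ζ_H = exp(2πi / e_H)`. -/
def zeta (H : Hyp G) : ℂ := Complex.exp (2 * Real.pi * Complex.I / ord H)

/-- `g_H`, the unique element of `G_H` whose determinant on `V` is `ζ_H`. -/
def gen (H : Hyp G) : G :=
  Classical.epsilon fun g : G => g ∈ stab H ∧ LinearMap.det (g.1 : V →ₗ[ℂ] V) = zeta H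

/-- The linear form `α_H(ξ) = ⟨ξ, v_H⟩`; the hermitian form is linear in the first variable in the
mathematical convention, which is the second variable of `inner`. -/
def alpha (v : Hyp G → V) (H : Hyp G) (ξ : V) : ℂ := inner ℂ (v H) ξ

/-- The constant `λ(g, H)` with `g v_H = λ(g, H) v_{gH}`. -/
def lam (v : Hyp G → V) (g : G) (H : Hyp G) : ℂ :=
  Classical.epsilon fun c : ℂ => g.1 (v H) = c • v (g • H)

/-- The basis of `M_G`: the symbols `[H; k]` with `1 ≤ k ≤ e_H - 1`. -/
def Sym (G : Subgroup (V ≃ₗ[ℂ] V)) : Type _ := Σ H : Hyp G, Finset.Icc 1 (ord H - 1)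

/-- The symbol `[H; k]`. -/
def sym (H : Hyp G) (k : Finset.Icc 1 (ord H - 1)) : Sym G := ⟨H, k⟩

/-- The symbol `[gH; k]`. -/
def smulSym (g : G) (x : Sym G) : Sym G :=
  sym (g • x.1) ⟨x.2.1, by rw [ord_smul]; exact x.2.2⟩

/-- The `G`-action on `M_G`: `g [H; k] = (conj λ(g, H))⁻¹ [gH; k]`. -/
def actM (v : Hyp G → V) (g : G) : (Sym G →₀ ℂ) →ₗ[ℂ] (Sym G →₀ ℂ) :=
  Finsupp.linearCombination ℂ fun x =>
    Finsupp.single (smulSym g x) ((starRingEnd ℂ) (lam v g x.1))⁻¹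

/-- The `G`-grading of `M_G`: `deg [H; k] = g_H ^ k`. -/
def degM (x : Sym G) : G := gen x.1 ^ x.2.1

/-- The Nichols-Woronowicz algebra `B(M_G)`. -/
abbrev BG (v : Hyp G → V) : Type _ := Nichols (actM v) (degM (G := G))

/-- The projection `T(M_G) → B(M_G)`. -/
abbrev toBG (v : Hyp G → V) : FreeAlgebra ℂ (Sym G) →ₐ[ℂ] BG v := toNichols (actM v) degM

/-- `μ(ξ) = - ∑_H ∑_{i, k = 1}^{e_H - 1} α_H(ξ) κ_{H,i} ζ_H^{-ik} [H; k]`. -/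
def mu [Finite G] (v : Hyp G → V) (κ : Hyp G → ℕ → ℂ) (ξ : V) : Sym G →₀ ℂ :=
  -∑ H : Hyp G, ∑ i ∈ Finset.Icc 1 (ord H - 1), ∑ k : Finset.Icc 1 (ord H - 1),
    Finsupp.single (sym H k) (alpha v H ξ * κ H i * zeta H ^ (-((i : ℤ) * (k.1 : ℤ))))

/-- `m : S(V) → B(M_G)` is the algebra homomorphism `μ̃` that extends `μ`. -/
def IsMuTilde [Finite G] (v : Hyp G → V) (κ : Hyp G → ℕ → ℂ)
    (m : SymmetricAlgebra ℂ V →ₐ[ℂ] BG v) : Prop :=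
  ∀ ξ : V, m (SymmetricAlgebra.ι ℂ V ξ) = toBG v (incl (mu v κ ξ))

/-- The action of `g` on `S(V)` by algebra automorphisms. -/
def actS (g : G) : SymmetricAlgebra ℂ V →ₐ[ℂ] SymmetricAlgebra ℂ V :=
  SymmetricAlgebra.lift (SymmetricAlgebra.ι ℂ V ∘ₗ (g.1 : V →ₗ[ℂ] V))

/-- The divided difference operator acting from the right, `(f - g_H^{-k} f) / v_H`: the unique
element of the integral domain `S(V)` whose product with `v_H` is `f - g_H^{-k} f`. -/
def divDiff (v : Hyp G → V) (H : Hyp G) (k : ℕ) (f : SymmetricAlgebra ℂ V) :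
    SymmetricAlgebra ℂ V :=
  Classical.epsilon fun q => q * SymmetricAlgebra.ι ℂ V (v H) = f - actS (gen H ^ k)⁻¹ f

/-- `D` is the braided derivation for `[H; k]`: it sends `[H'; k']` to `δ_{H,H'} δ_{k,k'}`, and, for
the product `φ ⋆ ψ = ψ φ` of the opposite algebra of `B(M_G)`, it satisfies the right braided Leibniz
rule `D (φ ⋆ ψ) = φ ⋆ D ψ + D φ ⋆ g_H^{-k} ψ`, that is, `D (ψ φ) = (D ψ) φ + (g_H^{-k} ψ) (D φ)`. Here
`g` acts on the class of `t` in `T(M_G)` as the class of `g t`. -/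
def IsBraidedDerivation (v : Hyp G → V) (H : Hyp G) (k : Finset.Icc 1 (ord H - 1))
    (D : BG v →ₗ[ℂ] BG v) : Prop :=
  (∀ x : Sym G, D (toBG v (FreeAlgebra.ι ℂ x)) =
    algebraMap ℂ (BG v) (Finsupp.single (sym H k) 1 x)) ∧
  ∀ (t : FreeAlgebra ℂ (Sym G)) (φ : BG v),
    D (toBG v t * φ) =
      D (toBG v t) * φ + toBG v (actT (actM v) (gen H ^ k.1)⁻¹ t) * D φ

/-- `C_{H,k} = ∑_{i=1}^{e_H - 1} κ_{H,i} ζ_H^{-ik} ‖v_H‖² / (ζ_H^{-k} - 1)`. -/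
def const (v : Hyp G → V) (κ : Hyp G → ℕ → ℂ) (H : Hyp G) (k : ℕ) : ℂ :=
  ∑ i ∈ Finset.Icc 1 (ord H - 1),
    κ H i * (zeta H ^ (-((i : ℤ) * (k : ℤ))) * ((‖v H‖ ^ 2 : ℝ) : ℂ) / (zeta H ^ (-(k : ℤ)) - 1))

end Reflection

end ReflNichols

end

/-! Both sides of the identity, as functions of `f`, vanish on constants and satisfy the same
twisted Leibniz rule: the divided difference is a skew derivation of S(V) relative to g_H^{-k}, the
braided derivation is one of B(M_G) relative to the action of the same element, and μ̃ intertwines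
the two actions. Hence it suffices to compare them on V, where each gives a scalar and C_{H,k} is
exactly the ratio that makes these scalars agree (`const_mul_divDiff_ι`,
`const_smul_muTilde_divDiff`).

The real work is that μ̃ and the derivations exist. Both rest on one description of the kernels of
the symmetrizers. For each letter x let ∂_x be the skew derivation of the tensor algebra with
∂_x(ab) = a ∂_x(b) + ∂_x(a) g_x(b), where g_x is the degree of x. Splitting S_{n+1} into cosets of
S_n gives σ_{n+1}(t) = ∑_x σ_n(∂_x t) ⊗ x, so σ_{n+1} kills t exactly when σ_n kills every ∂_x t
(`symmetrizer_succ_eq_zero_iff`).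

Consequently g_x^{-1} ∂_x preserves the relations and descends to the braided derivation
(`IsYetterDrinfeld.exists_braidedDerivation`). Also, μ(ξ) and μ(η) commute in B(M_G) because every
∂_x kills their commutator: g_x is a power of a reflection, so g_x μ(η) differs from μ(η) by a
multiple of α_H(η) μ(v_H), and ∂_x(μ(ξ)μ(η)) is symmetric in ξ and η (`rightDer_mu_commutator`). -/

noncomputable section
namespace ReflNichols

/-! ### Words and graded pieces of the tensor algebra -/

section Words

variable {I A : Type*} [Ring A] [Algebra ℂ A]

theorem word_nil : word ([] : List I) = 1 := rfl

theorem word_cons (x : I) (l : List I) : word (x :: l) = FreeAlgebra.ι ℂ x * word l := by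
  simp [word]

theorem basisFreeMonoid_apply (w : FreeMonoid I) :
    FreeAlgebra.basisFreeMonoid ℂ I w = word w.toList := by
  have h : FreeAlgebra.equivMonoidAlgebraFreeMonoid.symm (MonoidAlgebra.of ℂ (FreeMonoid I) w)
      = word w.toList := by
    simp [FreeAlgebra.equivMonoidAlgebraFreeMonoid, word, FreeMonoid.lift_apply]
  exact h

theorem linearMap_ext_word {f g : FreeAlgebra ℂ I →ₗ[ℂ] A} (h : ∀ l, f (word l) = g (word l)) :
    f = g :=
  (FreeAlgebra.basisFreeMonoid ℂ I).ext fun w => by rw [basisFreeMonoid_apply, h]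

theorem word_mem_tensorPow (l : List I) : word l ∈ tensorPow I l.length :=
  Submodule.subset_span ⟨l, rfl, rfl⟩

theorem linearMap_eq_of_tensorPow {f g : FreeAlgebra ℂ I →ₗ[ℂ] A} {n : ℕ}
    (h : ∀ l : List I, l.length = n → f (word l) = g (word l)) {t : FreeAlgebra ℂ I}
    (ht : t ∈ tensorPow I n) : f t = g t := by
  refine LinearMap.eqOn_span (R := ℂ) ?_ ht
  rintro _ ⟨l, hl, rfl⟩
  exact h l hl

theorem linearMap_mem_of_tensorPow {f : FreeAlgebra ℂ I →ₗ[ℂ] A} {n : ℕ} {P : Submodule ℂ A}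
    (h : ∀ l : List I, l.length = n → f (word l) ∈ P) {t : FreeAlgebra ℂ I}
    (ht : t ∈ tensorPow I n) : f t ∈ P := by
  have : tensorPow I n ≤ P.comap f := by
    refine Submodule.span_le.2 ?_
    rintro _ ⟨l, hl, rfl⟩
    exact h l hl
  exact this ht

theorem ι_mul_mem_tensorPow (x : I) {n : ℕ} {t : FreeAlgebra ℂ I} (ht : t ∈ tensorPow I n) :
    FreeAlgebra.ι ℂ x * t ∈ tensorPow I (n + 1) := by
  refine linearMap_mem_of_tensorPow (f := LinearMap.mulLeft ℂ (FreeAlgebra.ι ℂ x))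
    (P := tensorPow I (n + 1)) ?_ ht
  rintro l rfl
  rw [LinearMap.mulLeft_apply, ← word_cons]
  exact word_mem_tensorPow (x :: l)

theorem incl_single (x : I) (c : ℂ) : incl (Finsupp.single x c) = c • FreeAlgebra.ι ℂ x := by
  simp [incl]

theorem incl_mul_mem_tensorPow (m : I →₀ ℂ) {n : ℕ} {t : FreeAlgebra ℂ I}
    (ht : t ∈ tensorPow I n) : incl m * t ∈ tensorPow I (n + 1) := by
  induction m using Finsupp.induction_linear with
  | zero => simp
  | add a b ha hb => rw [map_add, add_mul]; exact add_mem ha hb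
  | single x c =>
    rw [incl_single, smul_mul_assoc]
    exact Submodule.smul_mem _ _ (ι_mul_mem_tensorPow x ht)

theorem one_mem_tensorPow : (1 : FreeAlgebra ℂ I) ∈ tensorPow I 0 :=
  word_mem_tensorPow []

end Words

/-! ### Skew derivations of the tensor algebra -/

section SkewDerivation

variable {I A : Type*} [Ring A] [Algebra ℂ A] (φ ψ : FreeAlgebra ℂ I →ₐ[ℂ] A) (d : I → A)

/-- The algebra homomorphism into upper triangular matrices that encodes a skew derivation. -/
def skewHom : FreeAlgebra ℂ I →ₐ[ℂ] Matrix (Fin 2) (Fin 2) A :=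
  FreeAlgebra.lift ℂ fun x =>
    !![φ (FreeAlgebra.ι ℂ x), d x; 0, ψ (FreeAlgebra.ι ℂ x)]

/-- The linear map `D` with `D x = d x` and `D (a b) = φ a * D b + D a * ψ b`. -/
def skewDer : FreeAlgebra ℂ I →ₗ[ℂ] A :=
  Matrix.entryLinearMap ℂ A 0 1 ∘ₗ (skewHom φ ψ d).toLinearMap

/-- The product of upper triangular matrices has the twisted Leibniz rule as its off-diagonal entry.
In this form a skew derivation descends to a quotient algebra whenever the matrix homomorphism
respects the relations. -/
theorem skewHom_eq (t : FreeAlgebra ℂ I) :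
    skewHom φ ψ d t = !![φ t, skewDer φ ψ d t; 0, ψ t] := by
  suffices h : skewHom φ ψ d t 0 0 = φ t ∧ skewHom φ ψ d t 1 0 = 0 ∧ skewHom φ ψ d t 1 1 = ψ t by
    ext i j
    fin_cases i <;> fin_cases j
    exacts [h.1, rfl, h.2.1, h.2.2]
  induction t using FreeAlgebra.induction with
  | grade0 r => simp [Matrix.algebraMap_matrix_apply]
  | grade1 x => simp [skewHom]
  | mul a b ha hb =>
    simp only [map_mul, Matrix.mul_apply, Fin.sum_univ_two, ha, hb]
    simp
  | add a b ha hb => simp [ha, hb]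

theorem skewDer_ι (x : I) : skewDer φ ψ d (FreeAlgebra.ι ℂ x) = d x := by
  simp [skewDer, skewHom]

theorem skewDer_mul (a b : FreeAlgebra ℂ I) :
    skewDer φ ψ d (a * b) = φ a * skewDer φ ψ d b + skewDer φ ψ d a * ψ b := by
  have h := congrFun (congrFun (map_mul (skewHom φ ψ d) a b) 0) 1
  rw [skewHom_eq, skewHom_eq φ ψ d a, skewHom_eq φ ψ d b] at h
  simpa [Matrix.mul_apply] using h

theorem skewDer_algebraMap (r : ℂ) : skewDer φ ψ d (algebraMap ℂ _ r) = 0 := by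
  simp [skewDer, Matrix.algebraMap_matrix_apply]

theorem skewDer_one : skewDer φ ψ d 1 = 0 := by
  simpa using skewDer_algebraMap φ ψ d 1

variable {φ ψ d}

theorem eq_skewDer (D : FreeAlgebra ℂ I →ₗ[ℂ] A) (h1 : ∀ x, D (FreeAlgebra.ι ℂ x) = d x)
    (h2 : ∀ a b, D (a * b) = φ a * D b + D a * ψ b) : D = skewDer φ ψ d := by
  have h0 : D 1 = 0 := by simpa using h2 1 1
  ext t
  induction t using FreeAlgebra.induction with
  | grade0 r => rw [skewDer_algebraMap, Algebra.algebraMap_eq_smul_one, map_smul, h0, smul_zero]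
  | grade1 x => rw [h1, skewDer_ι]
  | mul a b ha hb => rw [h2, skewDer_mul, ha, hb]
  | add a b ha hb => rw [map_add, map_add, ha, hb]

/-- The tensor algebra is free as a left module over itself on the last letter. -/
theorem eq_zero_of_sum_mul_ι_eq_zero [Fintype I] (a : I → FreeAlgebra ℂ I)
    (h : ∑ x, a x * FreeAlgebra.ι ℂ x = 0) (y : I) : a y = 0 := by
  -- With the augmentation as right twist, every `a x * D x` survives while `D (a x)` is multiplied
  -- by the augmentation of a letter, which is 0. The derivation dual to `y` thus reads off the
  -- coefficient `a y`.
  have hs := congrArg (skewDer (AlgHom.id ℂ (FreeAlgebra ℂ I))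
    ((Algebra.ofId ℂ (FreeAlgebra ℂ I)).comp FreeAlgebra.algebraMapInv)
    (fun x => algebraMap ℂ _ (Finsupp.single y 1 x))) h
  simp only [map_sum, skewDer_mul, skewDer_ι] at hs
  classical
  simpa [FreeAlgebra.algebraMapInv, Finsupp.single_apply, apply_ite] using hs

end SkewDerivation

/-! ### Yetter-Drinfeld modules: the braiding commutes with the group -/

section YetterDrinfeld

variable {I Γ : Type*}

/-- The operators `act` and the degrees `deg` make `M` a Yetter-Drinfeld module with monomial
action. -/
structure IsYetterDrinfeld [Group Γ] (act : Γ → (I →₀ ℂ) →ₗ[ℂ] (I →₀ ℂ)) (deg : I → Γ) : Prop where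
  act_one : ∀ m, act 1 m = m
  act_mul : ∀ g h m, act (g * h) m = act g (act h m)
  act_single : ∀ g x, ∃ (c : ℂ) (y : I),
    act g (Finsupp.single x 1) = c • Finsupp.single y 1 ∧ deg y = g * deg x * g⁻¹

variable {act : Γ → (I →₀ ℂ) →ₗ[ℂ] (I →₀ ℂ)} {deg : I → Γ}

theorem actT_ι (g : Γ) (x : I) :
    actT act g (FreeAlgebra.ι ℂ x) = incl (act g (Finsupp.single x 1)) := by
  simp [actT]

theorem actT_incl (g : Γ) (m : I →₀ ℂ) : actT act g (incl m) = incl (act g m) := by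
  have h : (actT act g).toLinearMap ∘ₗ incl = incl ∘ₗ act g := by
    ext x
    simp [incl_single, actT_ι]
  exact LinearMap.congr_fun h m

theorem actT_mem_tensorPow (g : Γ) {n : ℕ} {t : FreeAlgebra ℂ I} (ht : t ∈ tensorPow I n) :
    actT act g t ∈ tensorPow I n := by
  refine linearMap_mem_of_tensorPow (f := (actT act g).toLinearMap) ?_ ht
  intro l
  induction l generalizing n t with
  | nil =>
    rintro rfl
    simpa [word_nil] using one_mem_tensorPow
  | cons x l ih =>
    rintro rfl
    rw [word_cons, AlgHom.toLinearMap_apply, map_mul, actT_ι]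
    exact incl_mul_mem_tensorPow _ (ih (word_mem_tensorPow l) rfl)

theorem IsYetterDrinfeld.actT_actT [Group Γ] (h : IsYetterDrinfeld act deg) (g k : Γ)
    (t : FreeAlgebra ℂ I) : actT act g (actT act k t) = actT act (g * k) t := by
  have e : (actT act g).comp (actT act k) = actT act (g * k) := by
    ext x
    simp [actT_ι, actT_incl, h.act_mul]
  exact DFunLike.congr_fun e t

theorem IsYetterDrinfeld.actT_one [Group Γ] (h : IsYetterDrinfeld act deg) (t : FreeAlgebra ℂ I) :
    actT act 1 t = t := by
  have e : actT act 1 = AlgHom.id ℂ _ := by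
    ext x
    simp [actT_ι, h.act_one, incl_single]
  exact DFunLike.congr_fun e t

variable (act deg)

theorem braidAt_word (i : ℕ) (l : List I) :
    braidAt act deg i (word l) = braidWord act deg i l := by
  have h := (FreeAlgebra.basisFreeMonoid ℂ I).constr_basis ℂ
    (fun w => braidWord act deg i w.toList) (FreeMonoid.ofList l)
  rw [basisFreeMonoid_apply] at h
  exact h

theorem braidAt_one (i : ℕ) : braidAt act deg i 1 = 1 := by
  rw [← word_nil, braidAt_word]
  cases i <;> rfl

theorem braidAt_zero_ι (x : I) :
    braidAt act deg 0 (FreeAlgebra.ι ℂ x) = FreeAlgebra.ι ℂ x := by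
  have h : FreeAlgebra.ι ℂ x = word [x] := by simp [word]
  rw [h, braidAt_word]
  rfl

theorem braidAt_succ_ι_mul (i : ℕ) (x : I) (t : FreeAlgebra ℂ I) :
    braidAt act deg (i + 1) (FreeAlgebra.ι ℂ x * t) = FreeAlgebra.ι ℂ x * braidAt act deg i t := by
  have h : braidAt act deg (i + 1) ∘ₗ LinearMap.mulLeft ℂ (FreeAlgebra.ι ℂ x) =
      LinearMap.mulLeft ℂ (FreeAlgebra.ι ℂ x) ∘ₗ braidAt act deg i := by
    refine linearMap_ext_word fun l => ?_
    simp only [LinearMap.comp_apply, LinearMap.mulLeft_apply]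
    rw [← word_cons, braidAt_word, braidAt_word]
    rfl
  exact LinearMap.congr_fun h t

theorem braidAt_succ_incl_mul (i : ℕ) (m : I →₀ ℂ) (t : FreeAlgebra ℂ I) :
    braidAt act deg (i + 1) (incl m * t) = incl m * braidAt act deg i t := by
  induction m using Finsupp.induction_linear with
  | zero => simp
  | add a b ha hb => simp only [map_add, add_mul, ha, hb]
  | single x c => simp only [incl_single, smul_mul_assoc, map_smul, braidAt_succ_ι_mul]

theorem braidAt_zero_ι_mul_ι_mul (x y : I) (t : FreeAlgebra ℂ I) :
    braidAt act deg 0 (FreeAlgebra.ι ℂ x * (FreeAlgebra.ι ℂ y * t)) =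
      incl (act (deg x) (Finsupp.single y 1)) * (FreeAlgebra.ι ℂ x * t) := by
  have h : braidAt act deg 0 ∘ₗ LinearMap.mulLeft ℂ (FreeAlgebra.ι ℂ x) ∘ₗ
        LinearMap.mulLeft ℂ (FreeAlgebra.ι ℂ y) =
      LinearMap.mulLeft ℂ (incl (act (deg x) (Finsupp.single y 1))) ∘ₗ
        LinearMap.mulLeft ℂ (FreeAlgebra.ι ℂ x) := by
    refine linearMap_ext_word fun l => ?_
    simp only [LinearMap.comp_apply, LinearMap.mulLeft_apply]
    rw [← word_cons, ← word_cons, braidAt_word]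
    simp only [braidWord, mul_assoc]
  exact LinearMap.congr_fun h t

theorem braidAt_zero_ι_mul_incl_mul (x : I) (m : I →₀ ℂ) (t : FreeAlgebra ℂ I) :
    braidAt act deg 0 (FreeAlgebra.ι ℂ x * (incl m * t)) =
      incl (act (deg x) m) * (FreeAlgebra.ι ℂ x * t) := by
  induction m using Finsupp.induction_linear with
  | zero => simp
  | add a b ha hb => simp only [map_add, add_mul, mul_add, ha, hb]
  | single y c =>
    have hs : Finsupp.single y c = c • Finsupp.single y 1 := by simp
    rw [hs]
    simp only [map_smul, smul_mul_assoc, mul_smul_comm, incl_single, one_smul,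
      braidAt_zero_ι_mul_ι_mul]

variable {act deg}

/-- The degree condition is what is needed: g x has degree g (deg x) g⁻¹, which sends g y to g (deg
x) y. -/
theorem IsYetterDrinfeld.braidAt_actT [Group Γ] (h : IsYetterDrinfeld act deg) (g : Γ) (i : ℕ)
    (t : FreeAlgebra ℂ I) :
    braidAt act deg i (actT act g t) = actT act g (braidAt act deg i t) := by
  have e : braidAt act deg i ∘ₗ (actT act g).toLinearMap =
      (actT act g).toLinearMap ∘ₗ braidAt act deg i := by
    refine linearMap_ext_word fun l => ?_
    simp only [LinearMap.comp_apply, AlgHom.toLinearMap_apply]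
    induction l generalizing i with
    | nil => simp [word_nil, braidAt_one]
    | cons x l ih =>
      obtain ⟨c, x', hx, hdeg⟩ := h.act_single g x
      cases i with
      | succ i =>
        rw [word_cons, map_mul, actT_ι, braidAt_succ_incl_mul, ih, braidAt_succ_ι_mul, map_mul,
          actT_ι]
      | zero =>
        cases l with
        | nil => simp [word_cons, word_nil, braidAt_zero_ι, actT_ι, hx, incl_single]
        | cons y l =>
          simp only [word_cons, map_mul, braidAt_zero_ι_mul_ι_mul, actT_ι, actT_incl, hx, map_smul,
            incl_single, one_smul, smul_mul_assoc, braidAt_zero_ι_mul_incl_mul, mul_smul_comm]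
          rw [← h.act_mul, ← h.act_mul, hdeg, inv_mul_cancel_right]
  exact LinearMap.congr_fun e t

theorem IsYetterDrinfeld.braidAt_prod_actT [Group Γ] (h : IsYetterDrinfeld act deg) (g : Γ) (L : List ℕ)
    (t : FreeAlgebra ℂ I) :
    (L.map (braidAt act deg)).prod (actT act g t) =
      actT act g ((L.map (braidAt act deg)).prod t) := by
  induction L with
  | nil => rfl
  | cons i L ih => simp only [List.map_cons, List.prod_cons, Module.End.mul_apply, ih,
      h.braidAt_actT]

theorem IsYetterDrinfeld.symmetrizer_actT [Group Γ] (h : IsYetterDrinfeld act deg) (g : Γ) (n : ℕ)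
    (t : FreeAlgebra ℂ I) :
    symmetrizer act deg n (actT act g t) = actT act g (symmetrizer act deg n t) := by
  simp only [symmetrizer, LinearMap.sum_apply, braidPerm, h.braidAt_prod_actT, map_sum]

end YetterDrinfeld

end ReflNichols

end

noncomputable section
namespace ReflNichols

/-! ### Factorization of the symmetrizer through skew derivations -/

section Symmetrizer

variable {I Γ : Type*} (act : Γ → (I →₀ ℂ) →ₗ[ℂ] (I →₀ ℂ)) (deg : I → Γ)

/-- Ensures that Ψ_w for w in S_n never touches a letter appended at place n + 1. -/
theorem succ_lt_of_mem_redWord {n : ℕ} {w : Equiv.Perm (Fin n)} {i : ℕ} (hi : i ∈ redWord n w) :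
    i + 1 < n := by
  induction n with
  | zero => simp [redWord] at hi
  | succ n ih =>
    have hp : (w.symm (Fin.last n) : ℕ) ≤ n := Nat.lt_succ_iff.1 (w.symm (Fin.last n)).2
    simp only [redWord, List.mem_append, List.mem_reverse, List.mem_range'_1] at hi
    rcases hi with hi | hi
    · have := ih hi
      omega
    · omega

theorem length_eq_add_two {l : List I} {n : ℕ} (h : n + 1 < l.length) :
    ∃ x y l', l = x :: y :: l' := by
  match l, h with
  | x :: y :: l', _ => exact ⟨x, y, l', rfl⟩

theorem braidAt_mul_ι {n i : ℕ} (hi : i + 1 < n) (x : I) {t : FreeAlgebra ℂ I}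
    (ht : t ∈ tensorPow I n) :
    braidAt act deg i (t * FreeAlgebra.ι ℂ x) = braidAt act deg i t * FreeAlgebra.ι ℂ x := by
  refine linearMap_eq_of_tensorPow
    (f := braidAt act deg i ∘ₗ LinearMap.mulRight ℂ (FreeAlgebra.ι ℂ x))
    (g := LinearMap.mulRight ℂ (FreeAlgebra.ι ℂ x) ∘ₗ braidAt act deg i) ?_ ht
  rintro l rfl
  simp only [LinearMap.comp_apply, LinearMap.mulRight_apply]
  clear ht
  induction i generalizing l with
  | zero =>
    obtain ⟨y, z, l, rfl⟩ := length_eq_add_two hi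
    simp only [word_cons, mul_assoc, braidAt_zero_ι_mul_ι_mul]
  | succ i ih =>
    obtain ⟨y, z, l, rfl⟩ := length_eq_add_two (Nat.lt_of_succ_lt hi)
    rw [word_cons, mul_assoc, braidAt_succ_ι_mul, braidAt_succ_ι_mul, mul_assoc,
      ih (z :: l) (by simpa using hi)]

theorem braidAt_mem_tensorPow {n i : ℕ} {t : FreeAlgebra ℂ I} (ht : t ∈ tensorPow I n) :
    braidAt act deg i t ∈ tensorPow I n := by
  refine linearMap_mem_of_tensorPow ?_ ht
  rintro l rfl
  clear ht
  induction l generalizing i with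
  | nil =>
    rw [word_nil, braidAt_one]
    exact one_mem_tensorPow
  | cons x l ih =>
    cases i with
    | succ i =>
      rw [word_cons, braidAt_succ_ι_mul]
      exact ι_mul_mem_tensorPow x ih
    | zero =>
      cases l with
      | nil => simpa [word_cons, word_nil, braidAt_zero_ι] using word_mem_tensorPow [x]
      | cons y l =>
        rw [word_cons, word_cons, braidAt_zero_ι_mul_ι_mul]
        exact incl_mul_mem_tensorPow _ (ι_mul_mem_tensorPow _ (word_mem_tensorPow l))

theorem braidAt_prod_mul_ι {n : ℕ} (L : List ℕ) (hL : ∀ i ∈ L, i + 1 < n) (x : I)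
    {t : FreeAlgebra ℂ I} (ht : t ∈ tensorPow I n) :
    (L.map (braidAt act deg)).prod (t * FreeAlgebra.ι ℂ x) =
        (L.map (braidAt act deg)).prod t * FreeAlgebra.ι ℂ x ∧
      (L.map (braidAt act deg)).prod t ∈ tensorPow I n := by
  induction L with
  | nil => exact ⟨rfl, ht⟩
  | cons i L ih =>
    obtain ⟨h1, h2⟩ := ih fun j hj => hL j (List.mem_cons_of_mem _ hj)
    simp only [List.map_cons, List.prod_cons, Module.End.mul_apply, h1]
    exact ⟨braidAt_mul_ι act deg (hL i List.mem_cons_self) x h2, braidAt_mem_tensorPow act deg h2⟩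

theorem symmetrizer_mul_ι {n : ℕ} (x : I) {t : FreeAlgebra ℂ I} (ht : t ∈ tensorPow I n) :
    symmetrizer act deg n (t * FreeAlgebra.ι ℂ x) =
      symmetrizer act deg n t * FreeAlgebra.ι ℂ x := by
  simp only [symmetrizer, LinearMap.sum_apply, Finset.sum_mul]
  exact Finset.sum_congr rfl fun w _ =>
    (braidAt_prod_mul_ι act deg _ (fun i hi => succ_lt_of_mem_redWord hi) x ht).1

/-- The braiding of the factor `p` past the following `m` factors. -/
def moveRight (p m : ℕ) : Module.End ℂ (FreeAlgebra ℂ I) :=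
  ((List.range' p m).reverse.map (braidAt act deg)).prod

theorem moveRight_zero (p : ℕ) : moveRight act deg p 0 = 1 := rfl

theorem moveRight_succ (p m : ℕ) :
    moveRight act deg p (m + 1) = moveRight act deg (p + 1) m * braidAt act deg p := by
  simp [moveRight, List.range'_succ]

theorem moveRight_succ_incl_mul (p m : ℕ) (a : I →₀ ℂ) (t : FreeAlgebra ℂ I) :
    moveRight act deg (p + 1) m (incl a * t) = incl a * moveRight act deg p m t := by
  induction m generalizing p t with
  | zero => rfl
  | succ m ih =>
    rw [moveRight_succ, moveRight_succ, Module.End.mul_apply, Module.End.mul_apply,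
      braidAt_succ_incl_mul, ih]

theorem incl_single_one (x : I) : incl (Finsupp.single x 1) = FreeAlgebra.ι ℂ x := by
  rw [incl_single, one_smul]

theorem moveRight_succ_ι_mul (p m : ℕ) (x : I) (t : FreeAlgebra ℂ I) :
    moveRight act deg (p + 1) m (FreeAlgebra.ι ℂ x * t) =
      FreeAlgebra.ι ℂ x * moveRight act deg p m t := by
  rw [← incl_single_one, moveRight_succ_incl_mul]

/-- Each factor that the letter passes is acted on by the degree of the letter, and the letter
itself stays unchanged. -/
theorem moveRight_zero_ι_mul (x : I) {m : ℕ} {t : FreeAlgebra ℂ I} (ht : t ∈ tensorPow I m) :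
    moveRight act deg 0 m (FreeAlgebra.ι ℂ x * t) =
      actT act (deg x) t * FreeAlgebra.ι ℂ x := by
  refine linearMap_eq_of_tensorPow
    (f := moveRight act deg 0 m ∘ₗ LinearMap.mulLeft ℂ (FreeAlgebra.ι ℂ x))
    (g := LinearMap.mulRight ℂ (FreeAlgebra.ι ℂ x) ∘ₗ (actT act (deg x)).toLinearMap) ?_ ht
  rintro l rfl
  simp only [LinearMap.comp_apply, LinearMap.mulRight_apply, LinearMap.mulLeft_apply,
    AlgHom.toLinearMap_apply]
  clear ht
  induction l with
  | nil => simp [word_nil, moveRight_zero]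
  | cons y l ih =>
    rw [List.length_cons, moveRight_succ, Module.End.mul_apply, word_cons,
      braidAt_zero_ι_mul_ι_mul, moveRight_succ_incl_mul, ih, map_mul, actT_ι, mul_assoc]

/-- The right skew derivation of the tensor algebra dual to the letter `x`. -/
def rightDer (x : I) : FreeAlgebra ℂ I →ₗ[ℂ] FreeAlgebra ℂ I :=
  skewDer (AlgHom.id ℂ _) (actT act (deg x)) fun y => algebraMap ℂ _ (Finsupp.single x 1 y)

theorem rightDer_ι (x y : I) :
    rightDer act deg x (FreeAlgebra.ι ℂ y) = algebraMap ℂ _ (Finsupp.single x 1 y) :=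
  skewDer_ι _ _ _ _

theorem rightDer_mul (x : I) (a b : FreeAlgebra ℂ I) :
    rightDer act deg x (a * b) =
      a * rightDer act deg x b + rightDer act deg x a * actT act (deg x) b :=
  skewDer_mul _ _ _ _ _

theorem rightDer_one (x : I) : rightDer act deg x 1 = 0 := skewDer_one _ _ _

theorem rightDer_mem_tensorPow (x : I) {n : ℕ} {t : FreeAlgebra ℂ I}
    (ht : t ∈ tensorPow I (n + 1)) : rightDer act deg x t ∈ tensorPow I n := by
  refine linearMap_mem_of_tensorPow ?_ ht
  intro l hl
  induction l generalizing n t with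
  | nil => simp at hl
  | cons y l ih =>
    rw [word_cons, rightDer_mul, rightDer_ι]
    obtain rfl : l.length = n := by simpa using hl
    refine add_mem ?_ ?_
    · cases l with
      | nil => simp [word_nil, rightDer_one]
      | cons z l =>
        exact ι_mul_mem_tensorPow (n := l.length) y (ih (word_mem_tensorPow (z :: l)) rfl)
    · rw [← Algebra.smul_def]
      exact Submodule.smul_mem _ _ (actT_mem_tensorPow _ (word_mem_tensorPow l))

variable [Fintype I]

/-- Moving each letter in turn to the end is what the Leibniz rule for ∂_x records. On peeling off
the first letter, the summand p = 0 matches the term in which that letter is differentiated, and the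
others match the term in which it is kept. -/
theorem sum_moveRight {n : ℕ} {t : FreeAlgebra ℂ I} (ht : t ∈ tensorPow I (n + 1)) :
    ∑ p ∈ Finset.range (n + 1), moveRight act deg p (n - p) t =
      ∑ x, rightDer act deg x t * FreeAlgebra.ι ℂ x := by
  classical
  have key := linearMap_eq_of_tensorPow
    (f := ∑ p ∈ Finset.range (n + 1), moveRight act deg p (n - p))
    (g := ∑ x, LinearMap.mulRight ℂ (FreeAlgebra.ι ℂ x) ∘ₗ rightDer act deg x) ?_ ht
  · simpa using key
  intro l hl
  simp only [LinearMap.sum_apply, LinearMap.comp_apply, LinearMap.mulRight_apply]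
  clear ht
  induction l generalizing n with
  | nil => simp at hl
  | cons y l ih =>
    obtain rfl : l.length = n := by simpa using hl
    have hr : ∑ x, rightDer act deg x (word (y :: l)) * FreeAlgebra.ι ℂ x =
        FreeAlgebra.ι ℂ y * (∑ x, rightDer act deg x (word l) * FreeAlgebra.ι ℂ x) +
          actT act (deg y) (word l) * FreeAlgebra.ι ℂ y := by
      simp only [word_cons, rightDer_mul, rightDer_ι, add_mul, Finset.sum_add_distrib,
        Finset.mul_sum, mul_assoc]
      congr 1
      rw [Finset.sum_eq_single y]
      · simp
      · intro x _ hx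
        simp [hx]
      · simp
    rw [hr, Finset.sum_range_succ', Nat.sub_zero, word_cons,
      moveRight_zero_ι_mul _ _ _ (word_mem_tensorPow l)]
    congr 1
    cases l with
    | nil => simp [word_nil, rightDer_one]
    | cons z l =>
      rw [← ih (n := l.length) rfl, Finset.mul_sum]
      refine Finset.sum_congr rfl fun p hp => ?_
      rw [moveRight_succ_ι_mul]
      simp

omit [Fintype I] in
-- Coset decomposition of S_{n+1} over S_n: the chosen reduced word of w is the word of `dropLast w`
-- followed by the cycle moving the preimage of the last point to the end, so Ψ_w factors without
-- any appeal to the braid relations.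
theorem symmetrizer_succ (n : ℕ) :
    symmetrizer act deg (n + 1) =
      symmetrizer act deg n * ∑ p ∈ Finset.range (n + 1), moveRight act deg p (n - p) := by
  -- The pair determines the reduced word, which determines w; surjectivity follows from (n + 1)! =
  -- n! (n + 1).
  have hinj : Function.Injective fun w : Equiv.Perm (Fin (n + 1)) =>
      (dropLast w, w.symm (Fin.last n)) := by
    intro w w' h
    obtain ⟨h1, h2⟩ := Prod.mk.inj h
    have hr : redWord (n + 1) w = redWord (n + 1) w' := by
      simp only [redWord, h1, h2]
    ext j
    rw [← redWord_apply, ← redWord_apply, hr]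
  have hbij := (Fintype.bijective_iff_injective_and_card _).2
    ⟨hinj, by simp [Fintype.card_perm, Nat.factorial_succ, mul_comm]⟩
  rw [← Fin.sum_univ_eq_sum_range (fun p => moveRight act deg p (n - p)), symmetrizer, symmetrizer,
    Finset.sum_mul_sum, ← Fintype.sum_prod_type'
      (f := fun (u : Equiv.Perm (Fin n)) (p : Fin (n + 1)) =>
        braidPerm act deg u * moveRight act deg p (n - p))]
  refine Fintype.sum_bijective _ hbij _ _ fun w => ?_
  simp only [braidPerm, redWord, List.map_append, List.prod_append]
  rfl

theorem symmetrizer_succ_apply {n : ℕ} {t : FreeAlgebra ℂ I} (ht : t ∈ tensorPow I (n + 1)) :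
    symmetrizer act deg (n + 1) t =
      ∑ x, symmetrizer act deg n (rightDer act deg x t) * FreeAlgebra.ι ℂ x := by
  rw [symmetrizer_succ, Module.End.mul_apply, LinearMap.sum_apply, sum_moveRight _ _ ht, map_sum]
  exact Finset.sum_congr rfl fun x _ =>
    symmetrizer_mul_ι _ _ x (rightDer_mem_tensorPow _ _ x ht)

/-- The last letters are linearly independent over the tensor algebra, so the sum in
`symmetrizer_succ_apply` vanishes only termwise. -/
theorem symmetrizer_succ_eq_zero_iff {n : ℕ} {t : FreeAlgebra ℂ I}
    (ht : t ∈ tensorPow I (n + 1)) :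
    symmetrizer act deg (n + 1) t = 0 ↔
      ∀ x, symmetrizer act deg n (rightDer act deg x t) = 0 := by
  rw [symmetrizer_succ_apply _ _ ht]
  refine ⟨fun h => eq_zero_of_sum_mul_ι_eq_zero _ h, fun h => ?_⟩
  simp [h]

omit [Fintype I] in
theorem symmetrizer_zero : symmetrizer act deg 0 = 1 := by
  simp [symmetrizer, braidPerm, redWord]

end Symmetrizer

/-! ### Group action and braided derivations on the Nichols algebra -/

section BraidedDerivation

variable {I Γ : Type*} {act : Γ → (I →₀ ℂ) →ₗ[ℂ] (I →₀ ℂ)} {deg : I → Γ}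

theorem toNichols_eq_zero {n : ℕ} {t : FreeAlgebra ℂ I} (ht : t ∈ tensorPow I n)
    (h : symmetrizer act deg n t = 0) : toNichols act deg t = 0 := by
  rw [RingQuot.mkAlgHom_rel ℂ (NicholsRel.ker n t ht h), map_zero]

theorem toNichols_surjective : Function.Surjective (toNichols act deg) :=
  RingQuot.mkAlgHom_surjective ℂ _

variable [Group Γ]

theorem IsYetterDrinfeld.toNichols_actT_eq_zero (h : IsYetterDrinfeld act deg) (g : Γ) {n : ℕ}
    {t : FreeAlgebra ℂ I} (ht : t ∈ tensorPow I n) (h0 : symmetrizer act deg n t = 0) :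
    toNichols act deg (actT act g t) = 0 := by
  refine toNichols_eq_zero (actT_mem_tensorPow g ht) ?_
  rw [h.symmetrizer_actT, h0, map_zero]

/-- The diagonal action of `g` on `B(M)`. -/
theorem IsYetterDrinfeld.exists_actNichols (h : IsYetterDrinfeld act deg) (g : Γ) :
    ∃ a : Nichols act deg →ₐ[ℂ] Nichols act deg,
      ∀ t, a (toNichols act deg t) = toNichols act deg (actT act g t) := by
  refine ⟨RingQuot.liftAlgHom ℂ ⟨(toNichols act deg).comp (actT act g), ?_⟩, fun t => ?_⟩
  · rintro _ _ ⟨n, t, ht, h0⟩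
    rw [map_zero]
    exact h.toNichols_actT_eq_zero g ht h0
  · exact RingQuot.liftAlgHom_mkAlgHom_apply ..

/-- Applying g_x⁻¹ to ∂_x moves the twist from the right factor to the left one, giving the required
Leibniz rule. The matrix form passes to the quotient because ∂_x maps Ker σ_{n+1} to Ker σ_n and the
group preserves these kernels. -/
theorem IsYetterDrinfeld.exists_braidedDerivation [Finite I] (h : IsYetterDrinfeld act deg)
    (x : I) : ∃ D : Nichols act deg →ₗ[ℂ] Nichols act deg,
      (∀ y, D (toNichols act deg (FreeAlgebra.ι ℂ y)) =
        algebraMap ℂ _ (Finsupp.single x 1 y)) ∧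
      ∀ a b, D (toNichols act deg a * b) = D (toNichols act deg a) * b +
        toNichols act deg (actT act (deg x)⁻¹ a) * D b := by
  cases nonempty_fintype I
  let d : I → Nichols act deg := fun y => algebraMap ℂ _ (Finsupp.single x 1 y)
  let φ := (toNichols act deg).comp (actT act (deg x)⁻¹)
  have hD : (φ.toLinearMap ∘ₗ rightDer act deg x) = skewDer φ (toNichols act deg) d := by
    refine eq_skewDer _ (fun y => ?_) fun a b => ?_
    · simp [rightDer_ι, d]
    · simp [rightDer_mul, φ, h.actT_actT, h.actT_one]
  have hrel : ∀ ⦃s t⦄, NicholsRel act deg s t →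
      skewHom φ (toNichols act deg) d s = skewHom φ (toNichols act deg) d t := by
    rintro t _ ⟨n, _, ht, h0⟩
    have hφ : ∀ {n t}, t ∈ tensorPow I n → symmetrizer act deg n t = 0 → φ t = 0 :=
      fun ht h0 => h.toNichols_actT_eq_zero _ ht h0
    rw [map_zero, skewHom_eq, hφ ht h0, toNichols_eq_zero ht h0, ← hD]
    have hd : φ (rightDer act deg x t) = 0 := by
      cases n with
      | zero =>
        -- σ_0 is the identity, so there are no nontrivial relations in degree 0.
        rw [symmetrizer_zero] at h0
        obtain rfl : t = 0 := h0
        simp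
      | succ n =>
        have h1 := (symmetrizer_succ_eq_zero_iff _ _ ht).1 h0 x
        exact hφ (rightDer_mem_tensorPow _ _ x ht) h1
    rw [LinearMap.comp_apply, AlgHom.toLinearMap_apply, hd]
    ext i j
    fin_cases i <;> fin_cases j <;> rfl
  let Φ := RingQuot.liftAlgHom ℂ ⟨skewHom φ (toNichols act deg) d, hrel⟩
  let D := Matrix.entryLinearMap ℂ (Nichols act deg) 0 1 ∘ₗ Φ.toLinearMap
  have hΦ (t) : D (toNichols act deg t) = skewDer φ (toNichols act deg) d t := by
    have := RingQuot.liftAlgHom_mkAlgHom_apply ℂ (skewHom φ (toNichols act deg) d) hrel t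
    simp only [D, Φ, LinearMap.comp_apply, AlgHom.toLinearMap_apply, this]
    rfl
  refine ⟨D, fun y => by rw [hΦ, skewDer_ι], fun a b => ?_⟩
  obtain ⟨b, rfl⟩ := toNichols_surjective b
  rw [← map_mul, hΦ, hΦ, hΦ, skewDer_mul, add_comm]
  rfl

end BraidedDerivation

end ReflNichols

end

noncomputable section
namespace ReflNichols

/-! ### Reflections, their determinants and the generators g_H -/

section ReflectionGeometry

variable {V : Type*} [NormedAddCommGroup V] [InnerProductSpace ℂ V]

theorem mem_of_isCoatom_of_inner_eq_zero {H : Submodule ℂ V} (hH : IsCoatom H) {v : V}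
    (hv0 : v ≠ 0) (hv : v ∈ Hᗮ) (ξ : V) :
    ξ - ((inner ℂ v ξ : ℂ) / ((‖v‖ ^ 2 : ℝ) : ℂ)) • v ∈ H := by
  have hvv : (inner ℂ v v : ℂ) = ((‖v‖ ^ 2 : ℝ) : ℂ) := by
    rw [inner_self_eq_norm_sq_to_K]; push_cast; rfl
  have hn : ((‖v‖ ^ 2 : ℝ) : ℂ) ≠ 0 := by
    rw [← hvv]; exact inner_self_ne_zero.2 hv0
  have hvH : v ∉ H := fun h => inner_self_ne_zero.2 hv0 ((Submodule.mem_orthogonal H v).1 hv v h)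
  have htop : H ⊔ Submodule.span ℂ {v} = ⊤ := by
    refine hH.2 _ (lt_of_le_of_ne le_sup_left fun h => hvH ?_)
    rw [h]
    exact Submodule.mem_sup_right (Submodule.mem_span_singleton_self v)
  obtain ⟨x, hx, y, hy, rfl⟩ := Submodule.mem_sup.1 (htop ▸ Submodule.mem_top : ξ ∈ _)
  obtain ⟨c, rfl⟩ := Submodule.mem_span_singleton.1 hy
  have h0 : (inner ℂ v x : ℂ) = 0 := (Submodule.mem_orthogonal' H v).1 hv x hx
  rw [inner_add_right, h0, inner_smul_right, hvv, zero_add, mul_div_cancel_right₀ _ hn,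
    add_sub_cancel_right]
  exact hx

variable {G : Subgroup (V ≃ₗ[ℂ] V)} {v : Hyp G → V}

theorem isCoatom_hyp (H : Hyp G) : IsCoatom H.1 := by
  obtain ⟨_, _, h, _⟩ := H.2
  exact h

theorem norm_sq_ne_zero (hv : ∀ H, v H ≠ 0 ∧ v H ∈ H.1ᗮ) (H : Hyp G) :
    ((‖v H‖ ^ 2 : ℝ) : ℂ) ≠ 0 := by
  have := (hv H).1
  simpa using this

theorem alpha_self (H : Hyp G) : alpha v H (v H) = ((‖v H‖ ^ 2 : ℝ) : ℂ) := by
  rw [alpha, inner_self_eq_norm_sq_to_K]; push_cast; rfl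

theorem eq_smul_of_mem_orthogonal (hv : ∀ H, v H ≠ 0 ∧ v H ∈ H.1ᗮ) (H : Hyp G) {x : V}
    (hx : x ∈ H.1ᗮ) : x = (alpha v H x / ((‖v H‖ ^ 2 : ℝ) : ℂ)) • v H := by
  have h1 := mem_of_isCoatom_of_inner_eq_zero (isCoatom_hyp H) (hv H).1 (hv H).2 x
  have h2 : x - ((inner ℂ (v H) x : ℂ) / ((‖v H‖ ^ 2 : ℝ) : ℂ)) • v H ∈ H.1ᗮ :=
    sub_mem hx (Submodule.smul_mem _ _ (hv H).2)
  have h3 := (Submodule.mem_bot ℂ).1 (H.1.inf_orthogonal_eq_bot ▸ Submodule.mem_inf.2 ⟨h1, h2⟩)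
  exact sub_eq_zero.1 h3

theorem apply_mem_orthogonal (hinv : ∀ g ∈ G, ∀ x y : V, inner ℂ (g x) (g y) = inner ℂ x y)
    (g : G) (H : Hyp G) {x : V} (hx : x ∈ H.1ᗮ) : g.1 x ∈ (g • H).1ᗮ := by
  rw [Submodule.mem_orthogonal]
  rintro _ ⟨y, hy, rfl⟩
  exact (hinv g.1 g.2 y x).trans ((Submodule.mem_orthogonal _ _).1 hx y hy)

section Lam

variable (hinv : ∀ g ∈ G, ∀ x y : V, inner ℂ (g x) (g y) = inner ℂ x y)
  (hv : ∀ H, v H ≠ 0 ∧ v H ∈ H.1ᗮ)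

include hinv hv

theorem lam_spec (g : G) (H : Hyp G) : g.1 (v H) = lam v g H • v (g • H) := by
  have h : ∃ c : ℂ, g.1 (v H) = c • v (g • H) :=
    ⟨_, eq_smul_of_mem_orthogonal hv (g • H) (apply_mem_orthogonal hinv g H (hv H).2)⟩
  exact Classical.epsilon_spec h

theorem lam_ne_zero (g : G) (H : Hyp G) : lam v g H ≠ 0 := by
  intro h
  have h1 := lam_spec hinv hv g H
  rw [h, zero_smul] at h1
  exact (hv H).1 (by simpa using h1)

theorem lam_one (H : Hyp G) : lam v 1 H = 1 := by
  have h1 := lam_spec hinv hv 1 H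
  rw [one_smul] at h1
  have h2 : (1 - lam v 1 H) • v H = 0 := by
    rw [sub_smul, one_smul, ← h1]
    exact sub_self _
  exact (sub_eq_zero.1 ((smul_eq_zero.1 h2).resolve_right (hv H).1)).symm

theorem lam_mul (g h : G) (H : Hyp G) : lam v (g * h) H = lam v g (h • H) * lam v h H := by
  have h1 := lam_spec hinv hv (g * h) H
  have h2 : (g * h).1 (v H) = (lam v h H * lam v g (h • H)) • v (g • h • H) := by
    change g.1 (h.1 (v H)) = _
    rw [lam_spec hinv hv h H, map_smul, lam_spec hinv hv g, smul_smul]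
  rw [h2, show (g * h) • H = g • h • H from mul_smul g h H] at h1
  rw [mul_comm]
  exact (smul_left_injective ℂ (hv (g • h • H)).1 h1).symm

/-- Unitarity of g, with λ(g, H) leaving the antilinear slot as its conjugate; this explains the
coefficient in the action on M_G. -/
theorem alpha_smul (g : G) (H : Hyp G) (ξ : V) :
    alpha v (g • H) (g.1 ξ) = ((starRingEnd ℂ) (lam v g H))⁻¹ * alpha v H ξ := by
  have h0 : (starRingEnd ℂ) (lam v g H) ≠ 0 := by
    simpa using lam_ne_zero hinv hv g H
  have h1 := hinv g.1 g.2 (v H) ξ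
  rw [lam_spec hinv hv g H, inner_smul_left] at h1
  rw [eq_inv_mul_iff_mul_eq₀ h0]
  exact h1

end Lam

theorem mem_stab {H : Hyp G} {a : G} : a ∈ stab H ↔ ∀ x ∈ H.1, a.1 x = x := by
  rw [stab, mem_fixingSubgroup_iff]
  rfl

theorem conj_mem_stab {H : Hyp G} {a : G} (ha : a ∈ stab H) (g : G) :
    g * a * g⁻¹ ∈ stab (g • H) := by
  rw [mem_stab]
  rintro _ ⟨x, hx, rfl⟩
  have h3 : g.1⁻¹ (g.1 x) = x := g.1.symm_apply_apply x
  show g.1 (a.1 (g.1⁻¹ (g.1 x))) = g.1 x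
  rw [h3, mem_stab.1 ha x hx]

section Stabilizer

variable [FiniteDimensional ℂ V]
  (hinv : ∀ g ∈ G, ∀ x y : V, inner ℂ (g x) (g y) = inner ℂ x y)
  (hv : ∀ H, v H ≠ 0 ∧ v H ∈ H.1ᗮ)

include hinv hv

/-- A unitary map fixing H preserves the line spanned by v_H and scales it by some c. As V is the
sum of H and this line, c determines the map and equals its determinant. -/
theorem stab_apply {H : Hyp G} {a : G} (ha : a ∈ stab H) (ξ : V) :
    a.1 ξ = ξ + ((LinearMap.det (a.1 : V →ₗ[ℂ] V) - 1) *
      (alpha v H ξ / ((‖v H‖ ^ 2 : ℝ) : ℂ))) • v H := by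
  have hn := norm_sq_ne_zero hv H
  have haH : a • H = H := Subtype.ext <| by
    change H.1.map (a.1 : V →ₗ[ℂ] V) = H.1
    ext x
    constructor
    · rintro ⟨y, hy, rfl⟩
      exact (mem_stab.1 ha y hy).symm ▸ hy
    · exact fun hx => ⟨x, hx, mem_stab.1 ha x hx⟩
  have hav := lam_spec hinv hv a H
  rw [haH] at hav
  set c := lam v a H
  have hform (ξ : V) : a.1 ξ = ξ + ((c - 1) * (alpha v H ξ / ((‖v H‖ ^ 2 : ℝ) : ℂ))) • v H := by
    have h1 := mem_stab.1 ha _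
      (mem_of_isCoatom_of_inner_eq_zero (isCoatom_hyp H) (hv H).1 (hv H).2 ξ)
    rw [map_sub, map_smul, hav, sub_eq_iff_eq_add] at h1
    rw [h1, sub_mul, sub_smul, one_mul, mul_smul, smul_comm c, alpha]
    abel
  -- The map has the form ξ ↦ ξ + f(ξ) v_H, of determinant 1 + f(v_H) = c.
  let f : Module.Dual ℂ V := ((c - 1) / ((‖v H‖ ^ 2 : ℝ) : ℂ)) • (innerSL ℂ (v H)).toLinearMap
  have hf (ξ : V) : f ξ = (c - 1) * (alpha v H ξ / ((‖v H‖ ^ 2 : ℝ) : ℂ)) := by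
    change (c - 1) / ((‖v H‖ ^ 2 : ℝ) : ℂ) * alpha v H ξ = _
    ring
  have hat : (a.1 : V →ₗ[ℂ] V) = LinearMap.transvection f (v H) := by
    ext ξ
    rw [LinearMap.transvection.apply, hf]
    exact hform ξ
  have hdet : LinearMap.det (a.1 : V →ₗ[ℂ] V) = c := by
    rw [hat, LinearMap.transvection.det, hf, alpha_self, div_self hn]
    ring
  rw [hdet]
  exact hform ξ

theorem eq_of_mem_stab_of_det_eq {H : Hyp G} {a b : G} (ha : a ∈ stab H) (hb : b ∈ stab H)
    (h : LinearMap.det (a.1 : V →ₗ[ℂ] V) = LinearMap.det (b.1 : V →ₗ[ℂ] V)) : a = b := by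
  ext ξ
  rw [stab_apply hinv hv ha, stab_apply hinv hv hb, h]

omit [FiniteDimensional ℂ V] hinv hv in
theorem det_mul_coe (a b : G) : LinearMap.det ((a * b).1 : V →ₗ[ℂ] V) =
    LinearMap.det (a.1 : V →ₗ[ℂ] V) * LinearMap.det (b.1 : V →ₗ[ℂ] V) :=
  LinearMap.det_comp _ _

omit [FiniteDimensional ℂ V] hinv hv in
theorem det_pow_coe (a : G) (k : ℕ) : LinearMap.det ((a ^ k).1 : V →ₗ[ℂ] V) =
    LinearMap.det (a.1 : V →ₗ[ℂ] V) ^ k := by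
  induction k with
  | zero => exact LinearMap.det_id
  | succ k ih => rw [pow_succ, det_mul_coe, ih, pow_succ]

omit [FiniteDimensional ℂ V] hinv hv in
theorem det_inv_coe (a : G) : LinearMap.det ((a⁻¹).1 : V →ₗ[ℂ] V) =
    (LinearMap.det (a.1 : V →ₗ[ℂ] V))⁻¹ := by
  refine eq_inv_of_mul_eq_one_left ?_
  rw [← det_mul_coe, inv_mul_cancel]
  exact LinearMap.det_id

variable [Finite G]

omit [FiniteDimensional ℂ V] hinv hv in
theorem ord_pos (H : Hyp G) : 0 < ord H := Nat.card_pos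

omit [FiniteDimensional ℂ V] hinv hv in
theorem isPrimitiveRoot_zeta (H : Hyp G) : IsPrimitiveRoot (zeta H) (ord H) :=
  Complex.isPrimitiveRoot_exp _ (ord_pos H).ne'

/-- The determinant embeds G_H in the e_H-th roots of unity. Both sets have e_H elements, so ζ_H is
attained. -/
theorem gen_spec (H : Hyp G) :
    gen H ∈ stab H ∧ LinearMap.det ((gen H).1 : V →ₗ[ℂ] V) = zeta H := by
  suffices h : ∃ g : G, g ∈ stab H ∧ LinearMap.det (g.1 : V →ₗ[ℂ] V) = zeta H from
    Classical.epsilon_spec h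
  classical
  cases nonempty_fintype (stab H)
  let S : Finset ℂ :=
    Finset.univ.image fun a : stab H => LinearMap.det (a.1.1 : V →ₗ[ℂ] V)
  have hS : S.card = ord H := by
    rw [Finset.card_image_of_injective, Finset.card_univ, ord, Nat.card_eq_fintype_card]
    intro a b hab
    exact Subtype.ext (eq_of_mem_stab_of_det_eq hinv hv a.2 b.2 hab)
  have hsub : S ⊆ Polynomial.nthRootsFinset (ord H) (1 : ℂ) := by
    intro c hc
    obtain ⟨a, -, rfl⟩ := Finset.mem_image.1 hc
    rw [Polynomial.mem_nthRootsFinset (ord_pos H), ← det_pow_coe]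
    have : a.1 ^ ord H = 1 := by
      have h1 : a ^ Nat.card (stab H) = 1 := pow_card_eq_one'
      exact congrArg Subtype.val h1
    rw [this]
    exact LinearMap.det_id
  have heq := Finset.eq_of_subset_of_card_le hsub
    (by rw [hS, (isPrimitiveRoot_zeta H).card_nthRootsFinset])
  have hz : zeta H ∈ S := by
    rw [heq, Polynomial.mem_nthRootsFinset (ord_pos H)]
    exact (isPrimitiveRoot_zeta H).pow_eq_one
  obtain ⟨a, -, ha⟩ := Finset.mem_image.1 hz
  exact ⟨a.1, a.2, ha⟩

/-- Both sides fix gH pointwise and have determinant ζ_H, which determines the element. -/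
theorem gen_smul (g : G) (H : Hyp G) : gen (g • H) = g * gen H * g⁻¹ := by
  obtain ⟨h1, h2⟩ := gen_spec hinv hv H
  obtain ⟨h3, h4⟩ := gen_spec hinv hv (g • H)
  refine eq_of_mem_stab_of_det_eq hinv hv h3 (conj_mem_stab h1 g) ?_
  have hg : LinearMap.det (g.1 : V →ₗ[ℂ] V) ≠ 0 := (LinearEquiv.isUnit_det' g.1).ne_zero
  rw [h4, det_mul_coe, det_mul_coe, det_inv_coe, h2, mul_comm _ (zeta H),
    mul_inv_cancel_right₀ hg, zeta, zeta, ord_smul]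

theorem gen_pow_apply (H : Hyp G) (k : ℕ) (ξ : V) :
    (gen H ^ k).1 ξ = ξ + ((zeta H ^ k - 1) *
      (alpha v H ξ / ((‖v H‖ ^ 2 : ℝ) : ℂ))) • v H := by
  obtain ⟨h1, h2⟩ := gen_spec hinv hv H
  rw [stab_apply hinv hv ((stab H).pow_mem h1 k), det_pow_coe, h2]

theorem gen_pow_inv_apply (H : Hyp G) (k : ℕ) (ξ : V) :
    ((gen H ^ k)⁻¹).1 ξ = ξ + ((zeta H ^ (-(k : ℤ)) - 1) *
      (alpha v H ξ / ((‖v H‖ ^ 2 : ℝ) : ℂ))) • v H := by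
  obtain ⟨h1, h2⟩ := gen_spec hinv hv H
  rw [stab_apply hinv hv ((stab H).inv_mem ((stab H).pow_mem h1 k)), det_inv_coe, det_pow_coe, h2,
    zpow_neg, zpow_natCast]

end Stabilizer

end ReflectionGeometry

/-! ### M_G as a Yetter-Drinfeld module -/

section YetterDrinfeldModule

variable {V : Type*} [NormedAddCommGroup V] [InnerProductSpace ℂ V]
  {G : Subgroup (V ≃ₗ[ℂ] V)} {v : Hyp G → V}

instance [Finite G] : Fintype (Sym G) :=
  inferInstanceAs (Fintype (Σ H : Hyp G, Finset.Icc 1 (ord H - 1)))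

theorem sym_ext {x y : Sym G} (h1 : x.1 = y.1) (h2 : x.2.1 = y.2.1) : x = y := by
  obtain ⟨H, k, hk⟩ := x
  obtain ⟨K, l, hl⟩ := y
  obtain rfl : H = K := h1
  obtain rfl : k = l := h2
  rfl

theorem one_smulSym (x : Sym G) : smulSym 1 x = x := sym_ext (one_smul G x.1) rfl

theorem mul_smulSym (g h : G) (x : Sym G) : smulSym (g * h) x = smulSym g (smulSym h x) :=
  sym_ext (mul_smul g h x.1) rfl

theorem smulSym_bijective (g : G) : Function.Bijective (smulSym g : Sym G → Sym G) :=
  Function.bijective_iff_has_inverse.2 ⟨smulSym g⁻¹,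
    fun x => by rw [← mul_smulSym, inv_mul_cancel, one_smulSym],
    fun x => by rw [← mul_smulSym, mul_inv_cancel, one_smulSym]⟩

theorem actM_single (g : G) (x : Sym G) (c : ℂ) :
    actM v g (Finsupp.single x c) =
      Finsupp.single (smulSym g x) (((starRingEnd ℂ) (lam v g x.1))⁻¹ * c) := by
  simp [actM, mul_comm]

variable [FiniteDimensional ℂ V] [Finite G]
  (hinv : ∀ g ∈ G, ∀ x y : V, inner ℂ (g x) (g y) = inner ℂ x y)
  (hv : ∀ H, v H ≠ 0 ∧ v H ∈ H.1ᗮ)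

include hinv hv

theorem isYetterDrinfeld : IsYetterDrinfeld (actM v) (degM (G := G)) where
  act_one m := by
    induction m using Finsupp.induction_linear with
    | zero => simp
    | add a b ha hb => rw [map_add, ha, hb]
    | single x c => rw [actM_single, one_smulSym, lam_one hinv hv]; simp
  act_mul g h m := by
    induction m using Finsupp.induction_linear with
    | zero => simp
    | add a b ha hb => simp only [map_add, ha, hb]
    | single x c =>
      rw [actM_single, actM_single, actM_single, mul_smulSym, lam_mul hinv hv, map_mul, mul_inv,
        mul_assoc]
      rfl
  act_single g x := by
    refine ⟨((starRingEnd ℂ) (lam v g x.1))⁻¹, smulSym g x, ?_, ?_⟩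
    · rw [actM_single, mul_one, Finsupp.smul_single, smul_eq_mul, mul_one]
    · change gen (g • x.1) ^ x.2.1 = g * gen x.1 ^ x.2.1 * g⁻¹
      rw [gen_smul hinv hv, conj_pow]

end YetterDrinfeldModule

end ReflNichols

end

noncomputable section
namespace ReflNichols

/-! ### Homomorphisms from the symmetric algebra -/

section SymmetricAlgebraLift

open scoped IsMulCommutative in
/-- A linear map with commuting values in a possibly noncommutative algebra extends uniquely to the
symmetric algebra. -/
theorem existsUnique_symmetricAlgebra_lift {V A : Type*} [AddCommGroup V] [Module ℂ V] [Ring A]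
    [Algebra ℂ A] (f : V →ₗ[ℂ] A) (hf : ∀ x y, f x * f y = f y * f x) :
    ∃! m : SymmetricAlgebra ℂ V →ₐ[ℂ] A, ∀ x, m (SymmetricAlgebra.ι ℂ V x) = f x := by
  have hcomm : ∀ a ∈ Set.range f, ∀ b ∈ Set.range f, a * b = b * a := by
    rintro _ ⟨x, rfl⟩ _ ⟨y, rfl⟩
    exact hf x y
  -- The universal property needs a commutative target; the subalgebra generated by the commuting
  -- values serves as one.
  have := Algebra.isMulCommutative_adjoin ℂ hcomm
  let f' : V →ₗ[ℂ] Algebra.adjoin ℂ (Set.range f) :=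
    f.codRestrict (Subalgebra.toSubmodule (Algebra.adjoin ℂ (Set.range f)))
      fun x => Algebra.subset_adjoin ⟨x, rfl⟩
  refine ⟨(Algebra.adjoin ℂ (Set.range f)).val.comp (SymmetricAlgebra.lift f'), fun x => ?_,
    fun m hm => ?_⟩
  · rw [AlgHom.comp_apply, SymmetricAlgebra.lift_ι_apply]
    rfl
  · refine AlgHom.ext fun a => ?_
    induction a using SymmetricAlgebra.induction with
    | algebraMap r => simp only [AlgHom.commutes]
    | ι x =>
      rw [hm, AlgHom.comp_apply, SymmetricAlgebra.lift_ι_apply]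
      rfl
    | mul a b ha hb => rw [map_mul, map_mul, ha, hb]
    | add a b ha hb => rw [map_add, map_add, ha, hb]

theorem symmetricAlgebra_ι_ne_zero {V : Type*} [AddCommGroup V] [Module ℂ V] {x : V} (hx : x ≠ 0) :
    SymmetricAlgebra.ι ℂ V x ≠ 0 := by
  intro h
  obtain ⟨f, hf⟩ : ∃ f : Module.Dual ℂ V, f x ≠ 0 := by
    by_contra! h0
    exact hx ((Module.forall_dual_apply_eq_zero_iff ℂ x).1 h0)
  apply hf
  rw [← SymmetricAlgebra.lift_ι_apply f x, h, map_zero]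

end SymmetricAlgebraLift

variable {V : Type*} [NormedAddCommGroup V] [InnerProductSpace ℂ V]
  {G : Subgroup (V ≃ₗ[ℂ] V)} {v : Hyp G → V}

/-! ### Equivariance of μ and the homomorphism μ̃ -/

section Mu

variable [Finite G] {κ : Hyp G → ℕ → ℂ}

/-- The coefficient of `μ` at a symbol: `μ(ξ) = ∑ α_H(ξ) muCoeff [H; k] [H; k]`. -/
def muCoeff (κ : Hyp G → ℕ → ℂ) (x : Sym G) : ℂ :=
  -∑ i ∈ Finset.Icc 1 (ord x.1 - 1), κ x.1 i * zeta x.1 ^ (-((i : ℤ) * (x.2.1 : ℤ)))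

theorem mu_eq_sum (ξ : V) :
    mu v κ ξ = ∑ x : Sym G, Finsupp.single x (alpha v x.1 ξ * muCoeff κ x) := by
  refine Eq.trans ?_ (Fintype.sum_sigma fun x : (Σ H : Hyp G, Finset.Icc 1 (ord H - 1)) =>
    (Finsupp.single x (alpha v x.1 ξ * muCoeff κ x) : Sym G →₀ ℂ)).symm
  rw [mu, ← Finset.sum_neg_distrib]
  refine Finset.sum_congr rfl fun H _ => ?_
  rw [Finset.sum_comm, ← Finset.sum_neg_distrib]
  refine Finset.sum_congr rfl fun k _ => ?_
  have h : alpha v H ξ * muCoeff κ (sym H k) = -∑ i ∈ Finset.Icc 1 (ord H - 1),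
      alpha v H ξ * κ H i * zeta H ^ (-((i : ℤ) * (k.1 : ℤ))) := by
    simp only [muCoeff, mul_neg, Finset.mul_sum, mul_assoc]
    rfl
  refine Eq.trans ?_ (congrArg (Finsupp.lsingle (R := ℂ) (sym H k)) h.symm)
  rw [map_neg, map_sum]
  rfl

theorem mu_apply (ξ : V) (x : Sym G) : mu v κ ξ x = alpha v x.1 ξ * muCoeff κ x := by
  classical
  rw [mu_eq_sum, Finsupp.finsetSum_apply]
  simp [Finsupp.single_apply]

variable (v κ) in
/-- `μ` as a linear map. -/
def muLin : V →ₗ[ℂ] (Sym G →₀ ℂ) where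
  toFun := mu v κ
  map_add' ξ η := by
    ext x
    simp only [Finsupp.add_apply, mu_apply, alpha, inner_add_right, add_mul]
  map_smul' c ξ := by
    ext x
    simp only [Finsupp.smul_apply, mu_apply, alpha, inner_smul_right, RingHom.id_apply, smul_eq_mul,
      mul_assoc]

theorem muLin_apply (ξ : V) : muLin v κ ξ = mu v κ ξ := rfl

section

variable (hκ : ∀ (g : G) (H : Hyp G), ∀ i ∈ Finset.Icc 1 (ord H - 1), κ (g • H) i = κ H i)

include hκ

omit [Finite G] in
theorem muCoeff_smul (g : G) (x : Sym G) : muCoeff κ (smulSym g x) = muCoeff κ x := by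
  unfold muCoeff
  change -∑ i ∈ Finset.Icc 1 (ord (g • x.1) - 1),
    κ (g • x.1) i * zeta (g • x.1) ^ (-((i : ℤ) * (x.2.1 : ℤ))) = _
  rw [ord_smul, show zeta (g • x.1) = zeta x.1 by rw [zeta, zeta, ord_smul]]
  congr 1
  exact Finset.sum_congr rfl fun i hi => by rw [hκ g x.1 i hi]

variable (hinv : ∀ g ∈ G, ∀ x y : V, inner ℂ (g x) (g y) = inner ℂ x y)
  (hv : ∀ H, v H ≠ 0 ∧ v H ∈ H.1ᗮ)

include hinv hv

/-- The factor produced by the action on [H; k] is the one relating α_{gH}(gξ) to α_H(ξ), while κ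
and ζ are constant on orbits. -/
theorem actM_mu (g : G) (ξ : V) : actM v g (mu v κ ξ) = mu v κ (g.1 ξ) := by
  rw [mu_eq_sum, mu_eq_sum, map_sum]
  refine Fintype.sum_bijective _ (smulSym_bijective g) _ _ fun x => ?_
  rw [actM_single, muCoeff_smul hκ]
  congr 1
  change _ = alpha v (g • x.1) (g.1 ξ) * _
  rw [alpha_smul hinv hv, mul_assoc]

variable [FiniteDimensional ℂ V]

/-- For x = [H; k] and c its coefficient in μ, both sides are c (α_H(η) μ(ξ) + α_H(ξ) μ(η)) plus a
multiple of α_H(ξ) α_H(η) μ(v_H), the last term coming from the reflection formula for g_H^k η. -/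
theorem rightDer_mu_commutator (x : Sym G) (ξ η : V) :
    rightDer (actM v) degM x (incl (mu v κ ξ) * incl (mu v κ η)) =
      rightDer (actM v) degM x (incl (mu v κ η) * incl (mu v κ ξ)) := by
  have hincl (m : Sym G →₀ ℂ) :
      rightDer (actM v) degM x (incl m) = algebraMap ℂ _ (m x) := by
    induction m using Finsupp.induction_linear with
    | zero => simp
    | add a b ha hb => simp only [map_add, ha, hb, Finsupp.add_apply]
    | single y c =>
      classical
      rw [incl_single, map_smul, rightDer_ι, Algebra.smul_def, ← map_mul]
      simp [Finsupp.single_apply, eq_comm]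
  have hact (ζ : V) : actT (actM v) (degM x) (incl (mu v κ ζ)) = incl (mu v κ ζ +
      ((zeta x.1 ^ x.2.1 - 1) * (alpha v x.1 ζ / ((‖v x.1‖ ^ 2 : ℝ) : ℂ))) •
        mu v κ (v x.1)) := by
    rw [actT_incl, actM_mu hκ hinv hv, degM, gen_pow_apply hinv hv, ← muLin_apply, map_add, map_smul]
    rfl
  rw [rightDer_mul, rightDer_mul, hincl, hincl, hact, hact, ← Algebra.commutes,
    ← Algebra.commutes, ← Algebra.smul_def, ← Algebra.smul_def, ← Algebra.smul_def,
    ← Algebra.smul_def, ← map_smul, ← map_smul, ← map_smul, ← map_smul, ← map_add, ← map_add,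
    mu_apply, mu_apply]
  congr 1
  module

/-- The commutator lies in degree 2 and all its skew derivatives vanish, so σ_2 kills it. -/
theorem toBG_mu_commute (ξ η : V) :
    toBG v (incl (mu v κ ξ)) * toBG v (incl (mu v κ η)) =
      toBG v (incl (mu v κ η)) * toBG v (incl (mu v κ ξ)) := by
  rw [← map_mul (toBG v), ← map_mul (toBG v), ← sub_eq_zero, ← map_sub (toBG v)]
  have hmem (a b : Sym G →₀ ℂ) : incl a * incl b ∈ tensorPow (Sym G) 2 := by
    have := incl_mul_mem_tensorPow a (incl_mul_mem_tensorPow b (one_mem_tensorPow (I := Sym G)))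
    rwa [mul_one] at this
  have ht := sub_mem (hmem (mu v κ ξ) (mu v κ η)) (hmem (mu v κ η) (mu v κ ξ))
  refine toNichols_eq_zero ht ((symmetrizer_succ_eq_zero_iff _ _ ht).2 fun x => ?_)
  rw [map_sub, rightDer_mu_commutator hκ hinv hv, sub_self, map_zero]

theorem existsUnique_muTilde : ∃! m : SymmetricAlgebra ℂ V →ₐ[ℂ] BG v, IsMuTilde v κ m :=
  existsUnique_symmetricAlgebra_lift
    ((toBG v).toLinearMap ∘ₗ incl ∘ₗ muLin v κ) (toBG_mu_commute hκ hinv hv)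

/-- `μ̃` is equivariant. -/
theorem IsMuTilde.actS {m : SymmetricAlgebra ℂ V →ₐ[ℂ] BG v} (hm : IsMuTilde v κ m) (g : G)
    {f : SymmetricAlgebra ℂ V} {t : FreeAlgebra ℂ (Sym G)} (ht : toBG v t = m f) :
    toBG v (actT (actM v) g t) = m (actS g f) := by
  obtain ⟨a, ha⟩ := (isYetterDrinfeld hinv hv).exists_actNichols g
  rw [← ha, ht]
  clear ht
  induction f using SymmetricAlgebra.induction with
  | algebraMap r => simp only [AlgHom.commutes]
  | ι ξ =>
    rw [hm, ha, actT_incl, actM_mu hκ hinv hv, ReflNichols.actS, SymmetricAlgebra.lift_ι_apply,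
      LinearMap.comp_apply, hm]
    rfl
  | mul p q hp hq => simp only [map_mul, hp, hq]
  | add p q hp hq => simp only [map_add, hp, hq]

end

end Mu

/-! ### Divided differences on S(V) -/

section DividedDifference

variable [FiniteDimensional ℂ V] [Finite G]
  (hinv : ∀ g ∈ G, ∀ x y : V, inner ℂ (g x) (g y) = inner ℂ x y)
  (hv : ∀ H, v H ≠ 0 ∧ v H ∈ H.1ᗮ)

include hv in
omit [FiniteDimensional ℂ V] [Finite G] in
-- The rules for divided differences are proved by multiplying through by v_H and cancelling it.
theorem mul_ι_left_injective (H : Hyp G) {p q : SymmetricAlgebra ℂ V}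
    (h : p * SymmetricAlgebra.ι ℂ V (v H) = q * SymmetricAlgebra.ι ℂ V (v H)) : p = q :=
  mul_right_cancel₀ (symmetricAlgebra_ι_ne_zero (hv H).1) h

omit [FiniteDimensional ℂ V] [Finite G] in
theorem actS_ι (g : G) (ξ : V) :
    actS g (SymmetricAlgebra.ι ℂ V ξ) = SymmetricAlgebra.ι ℂ V (g.1 ξ) := by
  rw [actS, SymmetricAlgebra.lift_ι_apply]
  rfl

include hinv hv

/-- A power of g_H moves a vector by a multiple of v_H, and divisibility of f - g f by v_H passes to
sums and, through pq - g(p)g(q) = (p - gp) q + g(p)(q - gq), to products. -/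
theorem divDiff_mul_ι (H : Hyp G) (k : ℕ) (f : SymmetricAlgebra ℂ V) :
    divDiff v H k f * SymmetricAlgebra.ι ℂ V (v H) = f - actS (gen H ^ k)⁻¹ f := by
  suffices h : ∃ q, q * SymmetricAlgebra.ι ℂ V (v H) = f - actS (gen H ^ k)⁻¹ f from
    Classical.epsilon_spec h
  induction f using SymmetricAlgebra.induction with
  | algebraMap r => exact ⟨0, by simp⟩
  | ι ξ =>
    rw [actS_ι, gen_pow_inv_apply hinv hv]
    set c := (zeta H ^ (-(k : ℤ)) - 1) * (alpha v H ξ / ((‖v H‖ ^ 2 : ℝ) : ℂ))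
    refine ⟨algebraMap ℂ _ (-c), ?_⟩
    rw [← Algebra.smul_def, map_add, map_smul, neg_smul]
    abel
  | mul p q hp hq =>
    obtain ⟨a, ha⟩ := hp
    obtain ⟨b, hb⟩ := hq
    refine ⟨a * q + actS (gen H ^ k)⁻¹ p * b, ?_⟩
    rw [add_mul, mul_right_comm, ha, mul_assoc, hb, map_mul]
    ring
  | add p q hp hq =>
    obtain ⟨a, ha⟩ := hp
    obtain ⟨b, hb⟩ := hq
    refine ⟨a + b, ?_⟩
    rw [add_mul, ha, hb, map_add]
    ring

theorem divDiff_algebraMap (H : Hyp G) (k : ℕ) (r : ℂ) :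
    divDiff v H k (algebraMap ℂ _ r) = 0 := by
  refine mul_ι_left_injective hv H ?_
  rw [divDiff_mul_ι hinv hv]
  simp

theorem divDiff_ι (H : Hyp G) (k : ℕ) (ξ : V) :
    divDiff v H k (SymmetricAlgebra.ι ℂ V ξ) = algebraMap ℂ _
      (-((zeta H ^ (-(k : ℤ)) - 1) * (alpha v H ξ / ((‖v H‖ ^ 2 : ℝ) : ℂ)))) := by
  refine mul_ι_left_injective hv H ?_
  rw [divDiff_mul_ι hinv hv, actS_ι, gen_pow_inv_apply hinv hv, ← Algebra.smul_def, map_add,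
    map_smul, neg_smul]
  abel

theorem divDiff_add (H : Hyp G) (k : ℕ) (p q : SymmetricAlgebra ℂ V) :
    divDiff v H k (p + q) = divDiff v H k p + divDiff v H k q := by
  refine mul_ι_left_injective hv H ?_
  rw [add_mul]
  simp only [divDiff_mul_ι hinv hv, map_add]
  ring

theorem divDiff_mul (H : Hyp G) (k : ℕ) (p q : SymmetricAlgebra ℂ V) :
    divDiff v H k (p * q) =
      divDiff v H k p * q + actS (gen H ^ k)⁻¹ p * divDiff v H k q := by
  refine mul_ι_left_injective hv H ?_
  rw [add_mul, mul_right_comm, mul_assoc (actS _ p)]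
  simp only [divDiff_mul_ι hinv hv, map_mul]
  ring

end DividedDifference

/-! ### Comparison of the braided derivation with the divided difference -/

section Derivation

variable {H : Hyp G} {k : Finset.Icc 1 (ord H - 1)}

theorem IsBraidedDerivation.map_algebraMap {D : BG v →ₗ[ℂ] BG v}
    (hD : IsBraidedDerivation v H k D) (r : ℂ) : D (algebraMap ℂ _ r) = 0 := by
  have h := hD.2 1 1
  simp only [map_one, mul_one, one_mul, left_eq_add] at h
  rw [Algebra.algebraMap_eq_smul_one, map_smul, h, smul_zero]

theorem IsBraidedDerivation.map_incl {D : BG v →ₗ[ℂ] BG v}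
    (hD : IsBraidedDerivation v H k D) (m : Sym G →₀ ℂ) :
    D (toBG v (incl m)) = algebraMap ℂ _ (m (sym H k)) := by
  induction m using Finsupp.induction_linear with
  | zero => simp
  | add a b ha hb => simp only [map_add, ha, hb, Finsupp.add_apply]
  | single y c =>
    classical
    rw [incl_single, map_smul, map_smul, hD.1, Algebra.smul_def, ← map_mul]
    simp [Finsupp.single_apply, eq_comm]

theorem IsBraidedDerivation.unique {D D' : BG v →ₗ[ℂ] BG v}
    (hD : IsBraidedDerivation v H k D) (hD' : IsBraidedDerivation v H k D') : D = D' := by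
  ext φ
  obtain ⟨t, rfl⟩ := toNichols_surjective φ
  induction t using FreeAlgebra.induction with
  | grade0 r => rw [AlgHom.commutes, hD.map_algebraMap, hD'.map_algebraMap]
  | grade1 x => rw [hD.1, hD'.1]
  | mul a b ha hb => rw [map_mul, hD.2, hD'.2, ha, hb]
  | add a b ha hb => simp only [map_add, ha, hb]

variable [FiniteDimensional ℂ V] [Finite G]
  (hinv : ∀ g ∈ G, ∀ x y : V, inner ℂ (g x) (g y) = inner ℂ x y)
  (hv : ∀ H, v H ≠ 0 ∧ v H ∈ H.1ᗮ)

include hinv hv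

theorem existsUnique_braidedDerivation (H : Hyp G) (k : Finset.Icc 1 (ord H - 1)) :
    ∃! D : BG v →ₗ[ℂ] BG v, IsBraidedDerivation v H k D := by
  obtain ⟨D, hD⟩ := (isYetterDrinfeld hinv hv).exists_braidedDerivation (sym H k)
  exact ⟨D, hD, fun D' hD' => hD'.unique hD⟩

variable {κ : Hyp G → ℕ → ℂ}

omit [FiniteDimensional ℂ V] hinv in
-- The degree-one case, which dictates C_{H,k}: its factors ‖v_H‖² and 1 / (ζ_H^{-k} - 1) cancel
-- those of the divided difference of ξ.
theorem const_mul_divDiff_ι (ξ : V) :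
    const v κ H k.1 *
        -((zeta H ^ (-(k.1 : ℤ)) - 1) * (alpha v H ξ / ((‖v H‖ ^ 2 : ℝ) : ℂ))) =
      mu v κ ξ (sym H k) := by
  have hn := norm_sq_ne_zero hv H
  have hk := Finset.mem_Icc.1 k.2
  -- ζ_H is a primitive e_H-th root of unity and 1 ≤ k < e_H.
  have hz : zeta H ^ (-(k.1 : ℤ)) - 1 ≠ 0 := by
    rw [sub_ne_zero, zpow_neg, zpow_natCast, Ne, inv_eq_one]
    exact (isPrimitiveRoot_zeta H).pow_ne_one_of_pos_of_lt (by omega) (by omega)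
  rw [mu_apply]
  change _ = alpha v H ξ * -∑ i ∈ Finset.Icc 1 (ord H - 1),
    κ H i * zeta H ^ (-((i : ℤ) * (k.1 : ℤ)))
  rw [const, Finset.sum_mul, mul_neg, Finset.mul_sum, ← Finset.sum_neg_distrib]
  refine Finset.sum_congr rfl fun i _ => ?_
  field_simp

/-- In the product step the two Leibniz rules match term by term, since μ̃ carries the action of
g_H^{-k} on S(V) to that on B(M_G). -/
theorem const_smul_muTilde_divDiff
    (hκ : ∀ (g : G) (H : Hyp G), ∀ i ∈ Finset.Icc 1 (ord H - 1), κ (g • H) i = κ H i)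
    {m : SymmetricAlgebra ℂ V →ₐ[ℂ] BG v} {D : BG v →ₗ[ℂ] BG v} (hm : IsMuTilde v κ m)
    (hD : IsBraidedDerivation v H k D) (f : SymmetricAlgebra ℂ V) :
    const v κ H k • m (divDiff v H k f) = D (m f) := by
  induction f using SymmetricAlgebra.induction with
  | algebraMap r => rw [divDiff_algebraMap hinv hv, AlgHom.commutes, hD.map_algebraMap, map_zero,
      smul_zero]
  | ι ξ =>
    rw [divDiff_ι hinv hv, AlgHom.commutes, hm, hD.map_incl, Algebra.smul_def, ← map_mul,
      const_mul_divDiff_ι hv]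
  | mul p q hp hq =>
    -- The Leibniz rule of `D` expresses the group action through representatives in the tensor
    -- algebra, so one is chosen for μ̃(p).
    obtain ⟨t, ht⟩ := toNichols_surjective (m p)
    rw [divDiff_mul hinv hv, map_add, map_mul, map_mul, map_mul, ← ht, hD.2,
      hm.actS hκ hinv hv _ ht, ht, ← hp, ← hq, smul_add, smul_mul_assoc, mul_smul_comm]
  | add p q hp hq => rw [divDiff_add hinv hv, map_add, map_add, map_add, smul_add, hp, hq]

end Derivation

end ReflNichols

end

open ReflNichols in
theorem proposition4p3
    {V : Type*} [NormedAddCommGroup V] [InnerProductSpace ℂ V] [FiniteDimensional ℂ V]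
    (G : Subgroup (V ≃ₗ[ℂ] V)) [Finite G] (hG : IsReflectionGroup G)
    (hinv : ∀ g ∈ G, ∀ x y : V, inner ℂ (g x) (g y) = inner ℂ x y)
    (v : Hyp G → V) (hv : ∀ H, v H ≠ 0 ∧ v H ∈ H.1ᗮ)
    (κ : Hyp G → ℕ → ℂ)
    (hκ : ∀ (g : G) (H : Hyp G), ∀ i ∈ Finset.Icc 1 (ord H - 1), κ (g • H) i = κ H i) :
    (∃! m : SymmetricAlgebra ℂ V →ₐ[ℂ] BG v, IsMuTilde v κ m) ∧
    ∀ (H : Hyp G) (k : Finset.Icc 1 (ord H - 1)),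
      (∃! D : BG v →ₗ[ℂ] BG v, IsBraidedDerivation v H k D) ∧
      ∀ (m : SymmetricAlgebra ℂ V →ₐ[ℂ] BG v) (D : BG v →ₗ[ℂ] BG v),
        IsMuTilde v κ m → IsBraidedDerivation v H k D →
        ∀ f : SymmetricAlgebra ℂ V,
          const v κ H k • m (divDiff v H k f) = D (m f) :=
  ⟨existsUnique_muTilde hκ hinv hv, fun H k => ⟨existsUnique_braidedDerivation hinv hv H k,
    fun _ _ hm hD f => const_smul_muTilde_divDiff hinv hv hκ hm hD f⟩⟩
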